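/- Let $k$ be a field and let $A$ be a finite dimensional Hopf algebra over $k$ with invertible antipode $S$; write $\Delta(h)=\sum h'\otimes h''$. Let $A^{\circ}$ be the dual Hopf algebra with opposite comultiplication, i.e. $\langle \lambda\rho,a\rangle=\langle\lambda\otimes\rho,\Delta(a)\rangle$, $\langle\Delta(\lambda),a\otimes b\rangle=\langle\lambda,ba\rangle$ and $S(\lambda)=\lambda\circ S^{-1}$. Let $D(A)$ be the Drinfeld double: the Hopf algebra on the vector space $A^{\circ}\otimes A$, with $\lambda\otimes y=\lambda\cdot y$, which contains $A^{\circ}$ and $A$ as sub-Hopf algebras and whose product is determined by $$ y\cdot\lambda=\sum \langle\lambda',y'\rangle\,\langle S(\lambda'''),y'''\rangle\;\lambda''\cdot y'' . $$ Let $\mu\in A^*$ be a left integral and $x\in A$ a left cointegral with $\mu(x)=1$, that is, $\sum h'\mu(h'')=\mu(h)1$ and $hx=\epsilon(h)x$ for all $h\in A$. Define $\alpha\in A^*$ and $a\in A$ by $xh=\alpha(h)x$ and $\sum\mu(h')h''=\mu(h)a$, put $\omega=\alpha(a)$, and let $\mu_D\in D(A)^*$ be given by $\mu_D(\lambda\cdot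 y)=\lambda(x)\,\mu(S(y))$. Let $(e_i)$ be a basis of $A$ with dual basis $(f_i)$ of $A^{\circ}$, and put $u=\sum_i S(f_i)e_i$ and $\hat u=\sum_i S^2(e_i)f_i$ in $D(A)$. Suppose that $D(A)$ admits a balancing $\kappa$, that is, a group-like element $\kappa\in D(A)$ with $\kappa^2=u\hat u$ and $S^2(y)=\kappa y\kappa^{-1}$ for all $y\in D(A)$. Let $v=u\kappa^{-1}$ be the corresponding ribbon element, and define $\nu$ by $\nu^{-1}=\chi(\kappa)$, where $\chi(\lambda\cdot y)=\lambda(y)$. Define linear endomorphisms of $D(A)$ by $$ \mathcal S(X)=\sum_{i,j}\mu_D(X f_j e_i)\,S(f_i)S(e_j),\qquad \mathcal T(X)=vX . $$ Then $\nu^4=\omega$, the operator $\mathcal T$ is invertible, and $$ \mathcal S\,\mathcal T^{-1}\,\mathcal S=\nu^5\,\mathcal T\,\mathcal S\,\mathcal T . $$ -/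

import Mathlib

/-!
The Drinfeld double of a finite dimensional Hopf algebra with invertible antipode, constructed as a
Hopf algebra on the tensor product of the dual (with opposite comultiplication) and the algebra,
followed by integrals, moduli, balancings and the operators `S` and `T` on the double.
-/

noncomputable section

namespace HopfDouble

open scoped TensorProduct
open Coalgebra HopfAlgebra WithConv

/-- The antipode of `A` is invertible. -/
class HasBijectiveAntipode (k A : Type*) [Field k] [Ring A] [HopfAlgebra k A] : Prop where
  bijective : Function.Bijective (antipode k : A →ₗ[k] A)

/-- The dual space of `A` with the convolution product `⟨l m, a⟩ = ⟨l ⊗ m, Δ a⟩`; below it becomes a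
Hopf algebra with the opposite comultiplication `⟨Δ l, a ⊗ b⟩ = ⟨l, b a⟩` and antipode `l ∘ S⁻¹`. -/
def CoopDual (k A : Type*) [Field k] [Ring A] [HopfAlgebra k A] := WithConv (A →ₗ[k] k)

section
variable {k A : Type*} [Field k] [Ring A] [HopfAlgebra k A]

/-! ### inverse antipode -/
section Inv
variable [HasBijectiveAntipode k A]
variable (k A) in
/-- The antipode as a linear equivalence. -/
def antipodeEquiv : A ≃ₗ[k] A :=
  LinearEquiv.ofBijective (antipode k : A →ₗ[k] A) HasBijectiveAntipode.bijective

variable (k A) in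
/-- The inverse of the antipode. -/
def antipodeInv : A →ₗ[k] A := (antipodeEquiv k A).symm.toLinearMap

lemma antipodeInv_antipode (a : A) : antipodeInv k A (antipode k a) = a :=
  (antipodeEquiv k A).symm_apply_apply a

lemma antipode_antipodeInv (a : A) : antipode k (antipodeInv k A a) = a :=
  (antipodeEquiv k A).apply_symm_apply a

lemma antipode_inj {a b : A} (h : antipode k a = antipode k b) : a = b :=
  HasBijectiveAntipode.bijective.1 h

lemma antipodeInv_mul (a b : A) :
    antipodeInv k A (a * b) = antipodeInv k A b * antipodeInv k A a := by
  apply antipode_inj (k := k)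
  simp [antipode_antipodeInv, antipode_mul_antidistrib]

lemma antipodeInv_one : antipodeInv k A 1 = 1 := by
  apply antipode_inj (k := k); simp [antipode_antipodeInv]

lemma sum_mul_antipodeInv {ι : Type*} {a : A} (r : Repr k a ι) :
    ∑ i ∈ r.index, r.right i * antipodeInv k A (r.left i) = counit (R := k) a • 1 := by
  apply antipode_inj (k := k)
  simpa [antipode_antipodeInv, antipode_mul_antidistrib] using sum_mul_antipode_eq_smul r

lemma sum_antipodeInv_mul {ι : Type*} {a : A} (r : Repr k a ι) :
    ∑ i ∈ r.index, antipodeInv k A (r.right i) * r.left i = counit (R := k) a • 1 := by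
  apply antipode_inj (k := k)
  simpa [antipode_antipodeInv, antipode_mul_antidistrib] using sum_antipode_mul_eq_smul r
end Inv

/-! ### convolution -/
section Conv
variable {B : Type*} [Semiring B] [Algebra k B]
variable (k A) in
/-- The map `a ↦ ε(a) c`. -/
def cst (c : B) : WithConv (A →ₗ[k] B) := toConv ((counit (R := k) (A := A)).smulRight c)

lemma conv_mul_apply {a : A} (f g : WithConv (A →ₗ[k] B)) :
    (f * g) a = ∑ i ∈ (ℛ k a).index, f ((ℛ k a).left i) * g ((ℛ k a).right i) :=
  (ℛ k a).convMul_apply f g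

lemma cst_mul (c : B) (f : WithConv (A →ₗ[k] B)) (a : A) : (cst k A c * f) a = c * f a := by
  rw [conv_mul_apply]
  conv_rhs => rw [← sum_counit_smul (ℛ k a)]
  simp [cst, Finset.mul_sum]

lemma mul_cst (c : B) (f : WithConv (A →ₗ[k] B)) (a : A) : (f * cst k A c) a = f a * c := by
  rw [conv_mul_apply]
  have : a = ∑ i ∈ (ℛ k a).index, counit (R := k) ((ℛ k a).right i) • (ℛ k a).left i := by
    have := congr(TensorProduct.rid k A $(sum_tmul_counit_eq (ℛ k a)))
    rw [map_sum] at this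
    simpa only [TensorProduct.rid_tmul, one_smul] using this.symm
  conv_rhs => rw [this]
  simp [cst, Finset.sum_mul]
end Conv

/-! ### the dual algebra -/
section
instance : Ring (CoopDual k A) := inferInstanceAs (Ring (WithConv (A →ₗ[k] k)))
instance : Algebra k (CoopDual k A) := inferInstanceAs (Algebra k (WithConv (A →ₗ[k] k)))

variable (k A) in
/-- The identity map from `CoopDual` to the dual space. -/
def toDual : CoopDual k A ≃ₗ[k] Module.Dual k A where
  toFun l := WithConv.ofConv l
  invFun f := WithConv.toConv f
  left_inv _ := rfl
  right_inv _ := rfl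
  map_add' _ _ := rfl
  map_smul' _ _ := rfl

instance : CoeFun (CoopDual k A) fun _ => A → k := ⟨fun l => toDual k A l⟩

lemma coop_mul_apply (l m : CoopDual k A) (x : A) :
    (l * m) x = LinearMap.mul' k k (TensorProduct.map (toDual k A l) (toDual k A m) (comul x)) :=
  rfl

lemma coop_mul_repr (l m : CoopDual k A) {ι : Type*} {x : A} (r : Repr k x ι) :
    (l * m) x = ∑ i ∈ r.index, l (r.left i) * m (r.right i) := by
  rw [coop_mul_apply, ← r.eq]; simp

lemma coop_one_apply (x : A) : (1 : CoopDual k A) x = counit (R := k) x := rfl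
end

/-! ### translation actions on the dual -/
/-- `(y ▷ l)(x) = l (x y)`. -/
def actL (y : A) : CoopDual k A →ₗ[k] CoopDual k A where
  toFun l := (toDual k A).symm (toDual k A l ∘ₗ LinearMap.mulRight k y)
  map_add' _ _ := rfl
  map_smul' _ _ := rfl

/-- `(l ◁ y)(x) = l (y x)`. -/
def actR (y : A) : CoopDual k A →ₗ[k] CoopDual k A where
  toFun l := (toDual k A).symm (toDual k A l ∘ₗ LinearMap.mulLeft k y)
  map_add' _ _ := rfl
  map_smul' _ _ := rfl

@[simp] lemma actL_apply (y : A) (l : CoopDual k A) (x : A) : (actL y l) x = l (x * y) := rfl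
@[simp] lemma actR_apply (y : A) (l : CoopDual k A) (x : A) : (actR y l) x = l (y * x) := rfl

lemma coopDual_ext {l m : CoopDual k A} (h : ∀ x, l x = m x) : l = m :=
  (toDual k A).injective (LinearMap.ext h)

variable (k A) in
/-- The left action `▷` as an algebra homomorphism. -/
def actLHom : A →ₐ[k] Module.End k (CoopDual k A) where
  toFun := actL
  map_one' := LinearMap.ext fun l => coopDual_ext fun x => congrArg (toDual k A l) (mul_one x)
  map_mul' a b := LinearMap.ext fun l => coopDual_ext fun x =>
    congrArg (toDual k A l) (mul_assoc x a b).symm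
  map_zero' := LinearMap.ext fun l => coopDual_ext fun x => by simp
  map_add' a b := LinearMap.ext fun l => coopDual_ext fun x => by simp [mul_add]
  commutes' c := LinearMap.ext fun l => coopDual_ext fun x => by
    simp [Algebra.algebraMap_eq_smul_one]

variable (k A) in
/-- The left action `l ↦ l ◁ S⁻¹(y)` as an algebra homomorphism. -/
def actRInvHom [HasBijectiveAntipode k A] : A →ₐ[k] Module.End k (CoopDual k A) where
  toFun y := actR (antipodeInv k A y)
  map_one' := LinearMap.ext fun l => coopDual_ext fun x => by simp [antipodeInv_one]
  map_mul' a b := LinearMap.ext fun l => coopDual_ext fun x => by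
    simp [antipodeInv_mul, mul_assoc]
  map_zero' := LinearMap.ext fun l => coopDual_ext fun x => by simp
  map_add' a b := LinearMap.ext fun l => coopDual_ext fun x => by simp [add_mul]
  commutes' c := LinearMap.ext fun l => coopDual_ext fun x => by
    simp [Algebra.algebraMap_eq_smul_one, antipodeInv_one]

variable (k A) in
/-- The right action `◁` as a linear map. -/
def actRLin : A →ₗ[k] Module.End k (CoopDual k A) where
  toFun y := actR y
  map_add' a b := LinearMap.ext fun l => coopDual_ext fun x => by simp [add_mul]
  map_smul' c a := LinearMap.ext fun l => coopDual_ext fun x => by simp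

lemma conv_apply (l m : CoopDual k A) (x : A) :
    (l * m) x = ∑ i ∈ (ℛ k x).index, l ((ℛ k x).left i) * m ((ℛ k x).right i) :=
  coop_mul_repr l m _

lemma coop_sum_apply {ι : Type*} (s : Finset ι) (f : ι → CoopDual k A) (x : A) :
    (∑ i ∈ s, f i) x = ∑ i ∈ s, f i x := by
  rw [map_sum, LinearMap.sum_apply]

lemma actL_mul (y : A) (l m : CoopDual k A) : actL y (l * m) =
    ∑ i ∈ (ℛ k y).index, actL ((ℛ k y).left i) l * actL ((ℛ k y).right i) m := by
  apply coopDual_ext; intro x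
  rw [actL_apply, coop_mul_repr _ _ ((ℛ k x).mul (ℛ k y)), coop_sum_apply]
  simp_rw [conv_apply]
  simp only [Coalgebra.Repr.mul, Coalgebra.Repr.induced, Coalgebra.Repr.tmul,
    Finset.sum_product, actL_apply]
  rw [Finset.sum_comm]
  simp

lemma actR_mul (y : A) (l m : CoopDual k A) : actR y (l * m) =
    ∑ i ∈ (ℛ k y).index, actR ((ℛ k y).left i) l * actR ((ℛ k y).right i) m := by
  apply coopDual_ext; intro x
  rw [actR_apply, coop_mul_repr _ _ ((ℛ k y).mul (ℛ k x)), coop_sum_apply]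
  simp_rw [conv_apply]
  simp only [Coalgebra.Repr.mul, Coalgebra.Repr.induced, Coalgebra.Repr.tmul,
    Finset.sum_product, actR_apply]
  simp

/-! ### the bicrossed structure -/
section Bicross
variable {B : Type*} [Semiring B] [Algebra k B]

/-- For commuting algebra homomorphisms `f`, `g` the homomorphism `y ↦ ∑ f(y') g(y'')`. -/
def convHom (f g : A →ₐ[k] B) (h : ∀ x y, Commute (f x) (g y)) : A →ₐ[k] B :=
  (Algebra.TensorProduct.lift f g h).comp (Bialgebra.comulAlgHom k A)

lemma convHom_toConv (f g : A →ₐ[k] B) (h : ∀ x y, Commute (f x) (g y)) :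
    toConv (convHom f g h).toLinearMap = toConv f.toLinearMap * toConv g.toLinearMap := by
  apply WithConv.ext; ext y
  have h1 : (convHom f g h) y =
      Algebra.TensorProduct.lift f g h (comul y) := rfl
  simp only [AlgHom.toLinearMap_apply]
  rw [h1, conv_mul_apply, ← (ℛ k y).eq, map_sum]
  simp

/-- `y ↦ I (l ◁ y)`. -/
def transR (I : CoopDual k A →ₐ[k] B) (l : CoopDual k A) : WithConv (A →ₗ[k] B) :=
  toConv (I.toLinearMap ∘ₗ (actRLin k A).flip l)

/-- `y ↦ I (y ▷ l)`. -/
def transL (I : CoopDual k A →ₐ[k] B) (l : CoopDual k A) : WithConv (A →ₗ[k] B) :=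
  toConv (I.toLinearMap ∘ₗ (actLHom k A).toLinearMap.flip l)

lemma transR_apply (I : CoopDual k A →ₐ[k] B) (l : CoopDual k A) (y : A) :
    transR I l y = I (actR y l) := rfl

lemma transL_apply (I : CoopDual k A →ₐ[k] B) (l : CoopDual k A) (y : A) :
    transL I l y = I (actL y l) := rfl

/-- The defining relation of the double: `∑ J(y') I(l ◁ y'') = ∑ I(y' ▷ l) J(y'')`; this is the relation
`R Δ(y) = Δ'(y) R` for the canonical element `R`, contracted with `l`. -/
def Matched (I : CoopDual k A →ₐ[k] B) (J : A →ₐ[k] B) : Prop :=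
  ∀ l, toConv J.toLinearMap * transR I l = transL I l * toConv J.toLinearMap

/-- `l ⊗ y ↦ I(l) J(y)`. -/
def combine (I : CoopDual k A →ₐ[k] B) (J : A →ₐ[k] B) : CoopDual k A ⊗[k] A →ₗ[k] B :=
  LinearMap.mul' k B ∘ₗ TensorProduct.map I.toLinearMap J.toLinearMap

@[simp] lemma combine_tmul (I : CoopDual k A →ₐ[k] B) (J : A →ₐ[k] B) (l : CoopDual k A) (y : A) :
    combine I J (l ⊗ₜ y) = I l * J y := rfl

variable (k A) in
/-- `l · (m ⊗ z) = l m ⊗ z`. -/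
def dualMulHom : CoopDual k A →ₐ[k] Module.End k (CoopDual k A ⊗[k] A) :=
  (Module.End.rTensorAlgHom k (CoopDual k A) A).comp (Algebra.lmul k (CoopDual k A))

variable (k A) in
/-- `m ⊗ z ↦ m ⊗ y z`. -/
def algMulHom : A →ₐ[k] Module.End k (CoopDual k A ⊗[k] A) :=
  (Module.End.lTensorAlgHom k A (CoopDual k A)).comp (Algebra.lmul k A)

variable (k A) in
/-- `m ⊗ z ↦ (y ▷ m) ⊗ z`. -/
def transLHom : A →ₐ[k] Module.End k (CoopDual k A ⊗[k] A) :=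
  (Module.End.rTensorAlgHom k (CoopDual k A) A).comp (actLHom k A)

@[simp] lemma dualMulHom_tmul (l m : CoopDual k A) (y : A) :
    dualMulHom k A l (m ⊗ₜ y) = (l * m) ⊗ₜ y := rfl
@[simp] lemma algMulHom_tmul (z : A) (m : CoopDual k A) (y : A) :
    algMulHom k A z (m ⊗ₜ y) = m ⊗ₜ (z * y) := rfl
@[simp] lemma transLHom_tmul (z : A) (m : CoopDual k A) (y : A) :
    transLHom k A z (m ⊗ₜ y) = actL z m ⊗ₜ y := rfl

lemma commute_left (x y : A) : Commute (transLHom k A x) (algMulHom k A y) :=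
  TensorProduct.ext' fun _ _ => rfl

variable (k A) in
/-- `m ⊗ z ↦ ∑ (y' ▷ m) ⊗ y'' z`. -/
def leftHalf : A →ₐ[k] Module.End k (CoopDual k A ⊗[k] A) :=
  convHom (transLHom k A) (algMulHom k A) commute_left

lemma actL_actR (x y : A) (l : CoopDual k A) : actL x (actR y l) = actR y (actL x l) :=
  coopDual_ext fun z => congrArg (toDual k A l) (mul_assoc y z x).symm

lemma leftHalf_tmul (y : A) (l : CoopDual k A) (z : A) : leftHalf k A y (l ⊗ₜ z) =
    ∑ i ∈ (ℛ k y).index, actL ((ℛ k y).left i) l ⊗ₜ ((ℛ k y).right i * z) := by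
  have h : leftHalf k A y = ((toConv (transLHom k A).toLinearMap) *
      (toConv (algMulHom k A).toLinearMap)) y := by
    rw [← convHom_toConv (h := commute_left)]; rfl
  rw [h, conv_mul_apply, LinearMap.sum_apply]
  rfl

lemma actR_comp (a b : A) (l : CoopDual k A) : actR b (actR a l) = actR (a * b) l :=
  coopDual_ext fun z => congrArg (toDual k A l) (mul_assoc a b z).symm

lemma actR_one (l : CoopDual k A) : actR 1 l = l :=
  coopDual_ext fun z => congrArg (toDual k A l) (one_mul z)

lemma combine_dualMul (I : CoopDual k A →ₐ[k] B) (J : A →ₐ[k] B) (l : CoopDual k A)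
    (t : CoopDual k A ⊗[k] A) : combine I J (dualMulHom k A l t) = I l * combine I J t := by
  induction t with
  | zero => simp
  | add a b ha hb => simp [ha, hb, mul_add]
  | tmul m y => simp [mul_assoc]

lemma combine_leftHalf {I : CoopDual k A →ₐ[k] B} {J : A →ₐ[k] B} (h : Matched I J)
    (y : A) (l : CoopDual k A) (z : A) :
    combine I J (leftHalf k A y (l ⊗ₜ z)) = ∑ i ∈ (ℛ k y).index,
      J ((ℛ k y).left i) * I (actR ((ℛ k y).right i) l) * J z := by
  have h1 : ∑ i ∈ (ℛ k y).index, J ((ℛ k y).left i) * I (actR ((ℛ k y).right i) l) =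
      ∑ i ∈ (ℛ k y).index, I (actL ((ℛ k y).left i) l) * J ((ℛ k y).right i) := by
    have := congrArg (fun f : WithConv (A →ₗ[k] B) => f y) (h l)
    simp only [conv_mul_apply] at this
    exact this
  rw [leftHalf_tmul, map_sum, ← Finset.sum_mul, h1, Finset.sum_mul]
  simp [mul_assoc]

variable [HasBijectiveAntipode k A]

variable (k A) in
/-- `m ⊗ z ↦ (m ◁ S⁻¹(y)) ⊗ z`. -/
def transRInvHom : A →ₐ[k] Module.End k (CoopDual k A ⊗[k] A) :=
  (Module.End.rTensorAlgHom k (CoopDual k A) A).comp (actRInvHom k A)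

@[simp] lemma transRInvHom_tmul (z : A) (m : CoopDual k A) (y : A) :
    transRInvHom k A z (m ⊗ₜ y) = actR (antipodeInv k A z) m ⊗ₜ y := rfl

lemma commute_right (x y : A) : Commute (leftHalf k A x) (transRInvHom k A y) := by
  refine TensorProduct.ext' fun l z => ?_
  change leftHalf k A x (transRInvHom k A y (l ⊗ₜ z)) =
    transRInvHom k A y (leftHalf k A x (l ⊗ₜ z))
  simp only [transRInvHom_tmul, leftHalf_tmul, map_sum, actL_actR]

variable (k A) in
/-- `y · (m ⊗ z) = ∑ (y' ▷ m ◁ S⁻¹(y''')) ⊗ y'' z`, which is the bicrossed structure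
`y · m = ∑ ⟨m', y'⟩ ⟨S(m'''), y'''⟩ m'' · y''` of the double. -/
def algAct : A →ₐ[k] Module.End k (CoopDual k A ⊗[k] A) :=
  convHom (leftHalf k A) (transRInvHom k A) commute_right

lemma algAct_tmul (y : A) (l : CoopDual k A) (z : A) : algAct k A y (l ⊗ₜ z) =
    ∑ i ∈ (ℛ k y).index, leftHalf k A ((ℛ k y).left i)
      (actR (antipodeInv k A ((ℛ k y).right i)) l ⊗ₜ z) := by
  have h : algAct k A y = ((toConv (leftHalf k A).toLinearMap) *
      (toConv (transRInvHom k A).toLinearMap)) y := by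
    rw [← convHom_toConv (h := commute_right)]; rfl
  rw [h, conv_mul_apply, LinearMap.sum_apply]
  rfl

lemma combine_algAct {I : CoopDual k A →ₐ[k] B} {J : A →ₐ[k] B} (h : Matched I J)
    (y : A) (t : CoopDual k A ⊗[k] A) :
    combine I J (algAct k A y t) = J y * combine I J t := by
  induction t with
  | zero => simp
  | add a b ha hb => simp [ha, hb, mul_add]
  | tmul l z =>
    rw [algAct_tmul, map_sum]
    simp_rw [combine_leftHalf h, actR_comp, ← Finset.sum_mul]
    rw [combine_tmul, ← mul_assoc]
    congr 1
    let N : A ⊗[k] A →ₗ[k] B := I.toLinearMap ∘ₗ (actRLin k A).flip l ∘ₗ LinearMap.mul' k A ∘ₗ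
      TensorProduct.map (antipodeInv k A) LinearMap.id ∘ₗ (TensorProduct.comm k A A).toLinearMap
    have key := congrArg (LinearMap.mul' k B ∘ₗ TensorProduct.map J.toLinearMap N)
      (sum_map_tmul_tmul_eq (LinearMap.id : A →ₗ[k] A) LinearMap.id LinearMap.id y
        (repr := ℛ k y) (a₁ := fun i => ℛ k _) (a₂ := fun i => ℛ k _))
    have hN : ∀ b c, N (b ⊗ₜ c) = I (actR (antipodeInv k A c * b) l) := fun _ _ => rfl
    simp only [map_sum, LinearMap.comp_apply, TensorProduct.map_tmul, LinearMap.id_apply,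
      LinearMap.mul'_apply, hN, AlgHom.toLinearMap_apply] at key
    rw [← key]
    have h2 : ∀ c : A, ∑ j ∈ (ℛ k c).index,
        I (actR (antipodeInv k A ((ℛ k c).right j) * (ℛ k c).left j) l) =
        counit (R := k) c • I l := by
      intro c
      have h3 : ∀ a : A, I (actR a l) = (I.toLinearMap ∘ₗ (actRLin k A).flip l) a := fun _ => rfl
      simp_rw [h3]
      rw [← map_sum, sum_antipodeInv_mul, map_smul, ← h3, actR_one]
    simp_rw [← Finset.mul_sum, h2]
    have h4 := mul_cst (k := k) (A := A) (I l) (toConv J.toLinearMap) y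
    rw [conv_mul_apply] at h4
    exact h4

lemma combine_combine {I : CoopDual k A →ₐ[k] B} {J : A →ₐ[k] B} (h : Matched I J)
    (s t : CoopDual k A ⊗[k] A) :
    combine I J (combine (dualMulHom k A) (algAct k A) s t) = combine I J s * combine I J t := by
  induction s with
  | zero => simp
  | add a b ha hb => simp [ha, hb, add_mul]
  | tmul l y =>
    simp only [combine_tmul, Module.End.mul_apply]
    rw [combine_dualMul, combine_algAct h, mul_assoc]

lemma matched_self : Matched (dualMulHom k A) (algAct k A) := by
  intro l
  set σ : WithConv (A →ₗ[k] Module.End k (CoopDual k A ⊗[k] A)) :=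
    toConv ((Module.End.rTensorAlgHom k (CoopDual k A) A).toLinearMap ∘ₗ actRLin k A) with hσ
  have σ_tmul : ∀ (y : A) (m : CoopDual k A) (z : A), σ y (m ⊗ₜ z) = actR y m ⊗ₜ z :=
    fun _ _ _ => rfl
  set c := cst k A (dualMulHom k A l)
  have hσc : σ * c = transR (dualMulHom k A) l * σ := by
    apply WithConv.ext; ext1 y
    rw [mul_cst, conv_mul_apply]
    refine TensorProduct.ext' fun m z => ?_
    simp only [Module.End.mul_apply, dualMulHom_tmul, σ_tmul, LinearMap.sum_apply, actR_mul,
      TensorProduct.sum_tmul]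
    rfl
  have h1 : toConv (transRInvHom k A).toLinearMap * σ = 1 := by
    apply WithConv.ext; ext1 y
    rw [conv_mul_apply]
    refine TensorProduct.ext' fun m z => ?_
    have h3 : ∀ a : A, actR a m = (actRLin k A).flip m a := fun _ => rfl
    have : ∀ i, ((transRInvHom k A ((ℛ k y).left i)) * σ ((ℛ k y).right i)) (m ⊗ₜ[k] z) =
       (actRLin k A).flip m ((ℛ k y).right i * antipodeInv k A ((ℛ k y).left i)) ⊗ₜ z := by
      intro i
      rw [Module.End.mul_apply, σ_tmul, transRInvHom_tmul, actR_comp]; rfl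
    simp only [LinearMap.sum_apply]
    refine (Finset.sum_congr rfl fun i _ => this i).trans ?_
    rw [← TensorProduct.sum_tmul, ← map_sum, sum_mul_antipodeInv, map_smul, ← h3, actR_one]
    rfl
  have h2 : σ * toConv (transRInvHom k A).toLinearMap = 1 := by
    apply WithConv.ext; ext1 y
    rw [conv_mul_apply]
    refine TensorProduct.ext' fun m z => ?_
    have h3 : ∀ a : A, actR a m = (actRLin k A).flip m a := fun _ => rfl
    have : ∀ i, (σ ((ℛ k y).left i) * (transRInvHom k A ((ℛ k y).right i))) (m ⊗ₜ[k] z) =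
       (actRLin k A).flip m (antipodeInv k A ((ℛ k y).right i) * (ℛ k y).left i) ⊗ₜ z := by
      intro i
      rw [Module.End.mul_apply, transRInvHom_tmul, σ_tmul, actR_comp]; rfl
    simp only [LinearMap.sum_apply]
    refine (Finset.sum_congr rfl fun i _ => this i).trans ?_
    rw [← TensorProduct.sum_tmul, ← map_sum, sum_antipodeInv_mul, map_smul, ← h3, actR_one]
    rfl
  have h4 : toConv (transRInvHom k A).toLinearMap * transR (dualMulHom k A) l =
      c * toConv (transRInvHom k A).toLinearMap := by
    calc _ = toConv (transRInvHom k A).toLinearMap * (transR (dualMulHom k A) l * σ) *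
          toConv (transRInvHom k A).toLinearMap := by rw [mul_assoc, mul_assoc, h2, mul_one]
      _ = _ := by rw [← hσc, ← mul_assoc, h1, one_mul]
  have h5 : toConv (algMulHom k A).toLinearMap * c = c * toConv (algMulHom k A).toLinearMap := by
    apply WithConv.ext; ext1 y
    rw [mul_cst, cst_mul]
    exact TensorProduct.ext' fun _ _ => rfl
  have h6 : toConv (transLHom k A).toLinearMap * c =
      transL (dualMulHom k A) l * toConv (transLHom k A).toLinearMap := by
    apply WithConv.ext; ext1 y
    rw [mul_cst, conv_mul_apply]
    refine TensorProduct.ext' fun m z => ?_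
    have : ∀ i, (transL (dualMulHom k A) l ((ℛ k y).left i) *
        (transLHom k A ((ℛ k y).right i))) (m ⊗ₜ[k] z) =
        (actL ((ℛ k y).left i) l * actL ((ℛ k y).right i) m) ⊗ₜ z := fun _ => rfl
    simp only [LinearMap.sum_apply]
    refine Eq.trans ?_ (Finset.sum_congr rfl fun i _ => this i).symm
    rw [← TensorProduct.sum_tmul, ← actL_mul]
    rfl
  have h7 : toConv (algAct k A).toLinearMap = toConv (transLHom k A).toLinearMap *
      toConv (algMulHom k A).toLinearMap * toConv (transRInvHom k A).toLinearMap := by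
    rw [algAct, convHom_toConv, leftHalf, convHom_toConv]
  rw [h7, mul_assoc, h4, mul_assoc, ← mul_assoc _ c, h5, mul_assoc c, ← mul_assoc _ c, h6]
  simp only [mul_assoc]

end Bicross

/-! ### the dual Hopf algebra with opposite comultiplication -/
section Coop

variable (k A) in
/-- Evaluation at `a`. -/
def evalAt (a : A) : CoopDual k A →ₗ[k] k where
  toFun l := l a
  map_add' _ _ := rfl
  map_smul' _ _ := rfl

@[simp] lemma evalAt_apply (a : A) (l : CoopDual k A) : evalAt k A a l = l a := rfl

variable (k A) in
/-- Evaluation at `a ⊗ b`. -/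
def pairAt (a b : A) : CoopDual k A ⊗[k] CoopDual k A →ₗ[k] k :=
  LinearMap.mul' k k ∘ₗ TensorProduct.map (evalAt k A a) (evalAt k A b)

@[simp] lemma pairAt_tmul (a b : A) (l m : CoopDual k A) :
    pairAt k A a b (l ⊗ₜ m) = l a * m b := rfl

lemma pairAt_mul (a b : A) (s t : CoopDual k A ⊗[k] CoopDual k A) :
    pairAt k A a b (s * t) = ∑ i ∈ (ℛ k a).index, ∑ j ∈ (ℛ k b).index,
      pairAt k A ((ℛ k a).left i) ((ℛ k b).left j) s *
        pairAt k A ((ℛ k a).right i) ((ℛ k b).right j) t := by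
  induction s with
  | zero =>
    have h0 : (0 : CoopDual k A ⊗[k] CoopDual k A) * t = 0 := zero_mul t
    simp [h0]
  | add x y hx hy =>
    have h0 : (x + y) * t = x * t + y * t := add_mul x y t
    simp only [h0, add_mul, map_add, hx, hy, Finset.sum_add_distrib]
  | tmul l m =>
    induction t with
    | zero =>
      have h0 : (l ⊗ₜ[k] m) * (0 : CoopDual k A ⊗[k] CoopDual k A) = 0 := mul_zero _
      simp [h0]
    | add x y hx hy =>
      have h0 : (l ⊗ₜ[k] m) * (x + y) = (l ⊗ₜ[k] m) * x + (l ⊗ₜ[k] m) * y := mul_add _ x y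
      simp only [h0, mul_add, map_add, hx, hy, Finset.sum_add_distrib]
    | tmul l' m' =>
      rw [Algebra.TensorProduct.tmul_mul_tmul, pairAt_tmul, conv_apply, conv_apply,
        Finset.sum_mul_sum]
      refine Finset.sum_congr rfl fun i _ => Finset.sum_congr rfl fun j _ => ?_
      rw [pairAt_tmul, pairAt_tmul]
      ring

variable [FiniteDimensional k A]

lemma tensor_ext_of_separating {W : Type*} [AddCommGroup W] [Module k W] {J : Type*}
    (φ : J → W →ₗ[k] k) (hφ : ∀ w w' : W, (∀ j, φ j w = φ j w') → w = w')
    {s t : CoopDual k A ⊗[k] W}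
    (h : ∀ a j, LinearMap.mul' k k (TensorProduct.map (evalAt k A a) (φ j) s) =
      LinearMap.mul' k k (TensorProduct.map (evalAt k A a) (φ j) t)) : s = t := by
  let E := (TensorProduct.congr (toDual k A) (LinearEquiv.refl k W)).trans
    (dualTensorHomEquiv k A W)
  apply E.injective
  have hE : ∀ (a : A) (j : J) (x : CoopDual k A ⊗[k] W),
      φ j (E x a) = LinearMap.mul' k k (TensorProduct.map (evalAt k A a) (φ j) x) := by
    intro a j x
    induction x with
    | zero => simp
    | add x y hx hy => simp only [map_add, LinearMap.add_apply, hx, hy]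
    | tmul l w =>
      simp [E]
  ext1 a
  apply hφ
  intro j
  rw [hE, hE, h]

lemma coop_tensor_ext {s t : CoopDual k A ⊗[k] CoopDual k A}
    (h : ∀ a b, pairAt k A a b s = pairAt k A a b t) : s = t :=
  tensor_ext_of_separating (fun b => evalAt k A b) (fun _ _ h => coopDual_ext h) h

lemma coop_tensor_ext₃ {s t : CoopDual k A ⊗[k] (CoopDual k A ⊗[k] CoopDual k A)}
    (h : ∀ a b c, LinearMap.mul' k k (TensorProduct.map (evalAt k A a) (pairAt k A b c) s) =
      LinearMap.mul' k k (TensorProduct.map (evalAt k A a) (pairAt k A b c) t)) : s = t := by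
  have h1 : ∀ w w' : CoopDual k A ⊗[k] CoopDual k A,
      (∀ b : A × A, pairAt k A b.1 b.2 w = pairAt k A b.1 b.2 w') → w = w' :=
    fun _ _ h => coop_tensor_ext fun a b => h (a, b)
  exact tensor_ext_of_separating (fun b : A × A => pairAt k A b.1 b.2) h1
    fun a b => h a b.1 b.2

variable (k A) in
/-- The comultiplication `⟨Δ l, a ⊗ b⟩ = ⟨l, b a⟩`, see `pairAt_coopComul`. -/
def coopComul : CoopDual k A →ₗ[k] CoopDual k A ⊗[k] CoopDual k A :=
  TensorProduct.map (toDual k A).symm.toLinearMap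
      (toDual k A).symm.toLinearMap ∘ₗ
    (TensorProduct.dualDistribEquiv k A A).symm.toLinearMap ∘ₗ
    (LinearMap.mul' k A ∘ₗ (TensorProduct.comm k A A).toLinearMap).dualMap ∘ₗ
    (toDual k A).toLinearMap

lemma pairAt_coopComul (a b : A) (l : CoopDual k A) :
    pairAt k A a b (coopComul k A l) = l (b * a) := by
  have h : ∀ t : Module.Dual k A ⊗[k] Module.Dual k A,
      pairAt k A a b (TensorProduct.map (toDual k A).symm.toLinearMap
        (toDual k A).symm.toLinearMap t) =
      TensorProduct.dualDistribEquiv k A A t (a ⊗ₜ b) := by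
    intro t
    induction t with
    | zero => simp
    | add x y hx hy => simp only [map_add, LinearMap.add_apply, hx, hy]
    | tmul f g =>
      rw [TensorProduct.map_tmul, pairAt_tmul]
      exact (TensorProduct.dualDistrib_apply f g a b).symm
  rw [coopComul, LinearMap.comp_apply, h, LinearMap.comp_apply, LinearEquiv.coe_coe,
    LinearEquiv.apply_symm_apply]
  rfl

variable (k A) in
/-- `coopComul` as an algebra homomorphism. -/
def coopComulHom : CoopDual k A →ₐ[k] CoopDual k A ⊗[k] CoopDual k A :=
  AlgHom.ofLinearMap (coopComul k A)
    (coop_tensor_ext fun a b => by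
      rw [pairAt_coopComul, Algebra.TensorProduct.one_def, pairAt_tmul]
      change counit (R := k) (b * a) = counit (R := k) a * counit (R := k) b
      rw [Bialgebra.counit_mul, mul_comm])
    (fun l m => coop_tensor_ext fun a b => by
      rw [pairAt_coopComul, pairAt_mul, coop_mul_repr _ _ ((ℛ k b).mul (ℛ k a))]
      simp only [pairAt_coopComul, Coalgebra.Repr.mul, Coalgebra.Repr.induced, Coalgebra.Repr.tmul,
        Finset.sum_product]
      rw [Finset.sum_comm]
      simp)

variable (k A) in
/-- The counit `l ↦ l 1`. -/
def coopCounitHom : CoopDual k A →ₐ[k] k :=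
  AlgHom.ofLinearMap (evalAt k A 1)
    (by change counit (R := k) (1 : A) = 1; simp)
    (fun l m => by
      change (l * m) 1 = l 1 * m 1
      rw [coop_mul_apply, Bialgebra.comul_one, Algebra.TensorProduct.one_def]
      rfl)

instance : Bialgebra k (CoopDual k A) :=
  Bialgebra.ofAlgHom (coopComulHom k A) (coopCounitHom k A)
    (AlgHom.ext fun l => coop_tensor_ext₃ fun a b c => by
      have h1 : ∀ t : CoopDual k A ⊗[k] CoopDual k A,
          LinearMap.mul' k k (TensorProduct.map (evalAt k A a) (pairAt k A b c)
            (Algebra.TensorProduct.assoc k k k _ _ _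
              (Algebra.TensorProduct.map (coopComulHom k A) (.id k _) t))) =
          pairAt k A (b * a) c t := by
        intro t
        induction t with
        | zero => simp
        | add x y hx hy => simp only [map_add, hx, hy]
        | tmul l m =>
          rw [Algebra.TensorProduct.map_tmul, pairAt_tmul, ← pairAt_coopComul]
          change _ = pairAt k A a b (coopComulHom k A l) * _
          generalize coopComulHom k A l = s
          induction s with
          | zero => simp
          | add x y hx hy => simp only [map_add, TensorProduct.add_tmul, hx, hy, add_mul]
          | tmul p q => simp [mul_assoc]
      have h2 : ∀ t : CoopDual k A ⊗[k] CoopDual k A,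
          LinearMap.mul' k k (TensorProduct.map (evalAt k A a) (pairAt k A b c)
            (Algebra.TensorProduct.map (.id k _) (coopComulHom k A) t)) =
          pairAt k A a (c * b) t := by
        intro t
        induction t with
        | zero => simp
        | add x y hx hy => simp only [map_add, hx, hy]
        | tmul l m =>
          rw [Algebra.TensorProduct.map_tmul, pairAt_tmul, ← pairAt_coopComul]
          rfl
      refine (h1 (coopComulHom k A l)).trans (Eq.trans ?_ (h2 (coopComulHom k A l)).symm)
      change pairAt k A (b * a) c (coopComul k A l) = pairAt k A a (c * b) (coopComul k A l)
      rw [pairAt_coopComul, pairAt_coopComul, mul_assoc])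
    (AlgHom.ext fun l => by
      apply (TensorProduct.lid k (CoopDual k A)).injective
      refine coopDual_ext fun a => ?_
      have h1 : ∀ t : CoopDual k A ⊗[k] CoopDual k A,
          (TensorProduct.lid k (CoopDual k A)
            (Algebra.TensorProduct.map (coopCounitHom k A) (.id k _) t)) a =
          pairAt k A 1 a t := by
        intro t
        induction t with
        | zero => simp
        | add x y hx hy => simp only [map_add, LinearMap.add_apply, hx, hy]
        | tmul l m => rfl
      refine (h1 (coopComulHom k A l)).trans ?_
      change pairAt k A 1 a (coopComul k A l) = _
      rw [pairAt_coopComul]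
      simp)
    (AlgHom.ext fun l => by
      apply (TensorProduct.rid k (CoopDual k A)).injective
      refine coopDual_ext fun a => ?_
      have h1 : ∀ t : CoopDual k A ⊗[k] CoopDual k A,
          (TensorProduct.rid k (CoopDual k A)
            (Algebra.TensorProduct.map (.id k _) (coopCounitHom k A) t)) a =
          pairAt k A a 1 t := by
        intro t
        induction t with
        | zero => simp
        | add x y hx hy => simp only [map_add, LinearMap.add_apply, hx, hy]
        | tmul l m => exact mul_comm _ _
      refine (h1 (coopComulHom k A l)).trans ?_
      change pairAt k A a 1 (coopComul k A l) = _
      rw [pairAt_coopComul]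
      simp)

lemma coop_comul_eq (l : CoopDual k A) : comul (R := k) l = coopComul k A l := rfl
lemma coop_counit_eq (l : CoopDual k A) : counit (R := k) l = l 1 := rfl

variable [HasBijectiveAntipode k A]

variable (k A) in
/-- The antipode `l ↦ l ∘ S⁻¹`. -/
def coopAntipode : CoopDual k A →ₗ[k] CoopDual k A where
  toFun l := (toDual k A).symm (toDual k A l ∘ₗ antipodeInv k A)
  map_add' _ _ := rfl
  map_smul' _ _ := rfl

instance : HopfAlgebra k (CoopDual k A) where
  antipode := coopAntipode k A
  mul_antipode_rTensor_comul := LinearMap.ext fun l => coopDual_ext fun a => by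
    have h1 : ∀ t : CoopDual k A ⊗[k] CoopDual k A,
        (LinearMap.mul' k _ ((coopAntipode k A).rTensor _ t)) a =
        ∑ i ∈ (ℛ k a).index, pairAt k A (antipodeInv k A ((ℛ k a).left i)) ((ℛ k a).right i) t := by
      intro t
      induction t with
      | zero => simp
      | add x y hx hy =>
        simp only [map_add, LinearMap.add_apply, hx, hy,
          Finset.sum_add_distrib]
      | tmul l m => exact conv_apply _ _ _
    refine (h1 (coopComul k A l)).trans ?_
    simp only [pairAt_coopComul]
    rw [← map_sum, sum_mul_antipodeInv, map_smul]
    exact mul_comm _ _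
  mul_antipode_lTensor_comul := LinearMap.ext fun l => coopDual_ext fun a => by
    have h1 : ∀ t : CoopDual k A ⊗[k] CoopDual k A,
        (LinearMap.mul' k _ ((coopAntipode k A).lTensor _ t)) a =
        ∑ i ∈ (ℛ k a).index, pairAt k A ((ℛ k a).left i) (antipodeInv k A ((ℛ k a).right i)) t := by
      intro t
      induction t with
      | zero => simp
      | add x y hx hy =>
        simp only [map_add, LinearMap.add_apply, hx, hy,
          Finset.sum_add_distrib]
      | tmul l m => exact conv_apply _ _ _
    refine (h1 (coopComul k A l)).trans ?_
    simp only [pairAt_coopComul]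
    rw [← map_sum, sum_antipodeInv_mul, map_smul]
    exact mul_comm _ _

end Coop

/-! ### the Drinfeld double -/
section Double

/-- The double `D(A)`, with underlying space `A° ⊗ A`; the tensor `l ⊗ y` is the product `l · y`. -/
def DrinfeldDouble (k A : Type*) [Field k] [Ring A] [HopfAlgebra k A] := CoopDual k A ⊗[k] A

namespace DrinfeldDouble

instance : AddCommGroup (DrinfeldDouble k A) :=
  inferInstanceAs (AddCommGroup (CoopDual k A ⊗[k] A))
instance : Module k (DrinfeldDouble k A) := inferInstanceAs (Module k (CoopDual k A ⊗[k] A))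

lemma actL_unit (a : A) : actL a (1 : CoopDual k A) = counit (R := k) a • 1 :=
  coopDual_ext fun x => by
    rw [actL_apply, coop_one_apply, map_smul, LinearMap.smul_apply, coop_one_apply,
      Bialgebra.counit_mul, mul_comm]; rfl

lemma actR_unit (a : A) : actR a (1 : CoopDual k A) = counit (R := k) a • 1 :=
  coopDual_ext fun x => by
    rw [actR_apply, coop_one_apply, map_smul, LinearMap.smul_apply, coop_one_apply,
      Bialgebra.counit_mul]; rfl

lemma sum_right_counit_smul (y : A) :
    ∑ i ∈ (ℛ k y).index, counit (R := k) ((ℛ k y).right i) • (ℛ k y).left i = y := by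
  have := congr(TensorProduct.rid k A $(sum_tmul_counit_eq (ℛ k y)))
  rw [map_sum] at this
  simpa only [TensorProduct.rid_tmul, one_smul] using this

lemma matched_comp {B C : Type*} [Semiring B] [Algebra k B] [Semiring C] [Algebra k C]
    {I : CoopDual k A →ₐ[k] B} {J : A →ₐ[k] B} (h : Matched I J) (f : B →ₐ[k] C) :
    Matched (f.comp I) (f.comp J) := by
  intro l
  apply WithConv.ext; ext1 y
  have := congrArg (fun g : WithConv (A →ₗ[k] B) => f (g y)) (h l)
  simp only [conv_mul_apply, map_sum, map_mul] at this ⊢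
  exact this

section
variable [FiniteDimensional k A]

lemma comul_actR (y : A) (l : CoopDual k A) :
    comul (R := k) (actR y l) = (actR (k := k) y).lTensor _ (comul (R := k) l) := by
  refine coop_tensor_ext fun a b => ?_
  have : ∀ t, pairAt k A a b ((actR (k := k) y).lTensor _ t) = pairAt k A a (y * b) t := by
    intro t
    induction t with
    | zero => simp
    | add u v hu hv => simp only [map_add, hu, hv]
    | tmul l m => rfl
  rw [this, coop_comul_eq, coop_comul_eq, pairAt_coopComul, pairAt_coopComul, actR_apply, mul_assoc]

lemma comul_actL (y : A) (l : CoopDual k A) :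
    comul (R := k) (actL y l) = (actL (k := k) y).rTensor _ (comul (R := k) l) := by
  refine coop_tensor_ext fun a b => ?_
  have : ∀ t, pairAt k A a b ((actL (k := k) y).rTensor _ t) = pairAt k A (a * y) b t := by
    intro t
    induction t with
    | zero => simp
    | add u v hu hv => simp only [map_add, hu, hv]
    | tmul l m => rfl
  rw [this, coop_comul_eq, coop_comul_eq, pairAt_coopComul, pairAt_coopComul, actL_apply, mul_assoc]

lemma comul_balanced (y : A) (l : CoopDual k A) :
    (actL (k := k) y).lTensor _ (comul (R := k) l) =
      (actR (k := k) y).rTensor _ (comul (R := k) l) := by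
  refine coop_tensor_ext fun a b => ?_
  have h1 : ∀ t, pairAt k A a b ((actL (k := k) y).lTensor _ t) = pairAt k A a (b * y) t := by
    intro t
    induction t with
    | zero => simp
    | add u v hu hv => simp only [map_add, hu, hv]
    | tmul l m => rfl
  have h2 : ∀ t, pairAt k A a b ((actR (k := k) y).rTensor _ t) = pairAt k A (y * a) b t := by
    intro t
    induction t with
    | zero => simp
    | add u v hu hv => simp only [map_add, hu, hv]
    | tmul l m => rfl
  rw [h1, h2, coop_comul_eq, pairAt_coopComul, pairAt_coopComul, mul_assoc]

end

variable [HasBijectiveAntipode k A]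

variable (k A) in
/-- The product of the double: `(l ⊗ y) (m ⊗ z) = ∑ l (y' ▷ m ◁ S⁻¹(y''')) ⊗ y'' z`. -/
def leftMul : DrinfeldDouble k A →ₗ[k] (DrinfeldDouble k A →ₗ[k] DrinfeldDouble k A) :=
  combine (dualMulHom k A) (algAct k A)

instance : Mul (DrinfeldDouble k A) := ⟨fun s t => leftMul k A s t⟩
instance : One (DrinfeldDouble k A) := ⟨(1 : CoopDual k A) ⊗ₜ[k] (1 : A)⟩

lemma mul_def (s t : DrinfeldDouble k A) : s * t = leftMul k A s t := rfl

lemma counit_antipodeInv (a : A) : counit (R := k) (antipodeInv k A a) = counit (R := k) a := by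
  rw [← counit_antipode (R := k) (antipodeInv k A a), antipode_antipodeInv]

lemma leftHalf_unit (y z : A) : leftHalf k A y ((1 : CoopDual k A) ⊗ₜ z) = 1 ⊗ₜ (y * z) := by
  rw [leftHalf_tmul]
  simp_rw [actL_unit, TensorProduct.smul_tmul, ← TensorProduct.tmul_sum, ← smul_mul_assoc,
    ← Finset.sum_mul, sum_counit_smul]

lemma algAct_unit (y z : A) : algAct k A y ((1 : CoopDual k A) ⊗ₜ z) = 1 ⊗ₜ (y * z) := by
  rw [algAct_tmul]
  simp_rw [actR_unit, counit_antipodeInv, TensorProduct.smul_tmul, leftHalf_unit, mul_smul_comm,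
    ← TensorProduct.tmul_sum, ← smul_mul_assoc, ← Finset.sum_mul, sum_right_counit_smul]

lemma leftMul_one (s : DrinfeldDouble k A) :
    leftMul k A s ((1 : CoopDual k A) ⊗ₜ[k] (1 : A)) = s := by
  change CoopDual k A ⊗[k] A at s
  induction s with
  | zero => exact LinearMap.congr_fun (map_zero (leftMul k A)) _
  | add a b ha hb =>
    refine (LinearMap.congr_fun (map_add (leftMul k A) a b) _).trans ?_
    exact congrArg₂ (· + ·) ha hb
  | tmul l y =>
    change dualMulHom k A l (algAct k A y (1 ⊗ₜ 1)) = _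
    rw [algAct_unit, dualMulHom_tmul, mul_one, mul_one]

instance : Ring (DrinfeldDouble k A) where
  __ := (inferInstance : AddCommGroup (DrinfeldDouble k A))
  mul_assoc a b c := LinearMap.congr_fun (combine_combine (matched_self (k := k) (A := A)) a b) c
  one_mul a := by
    have h : leftMul k A ((1 : CoopDual k A) ⊗ₜ[k] (1 : A)) = LinearMap.id := by
      change dualMulHom k A 1 * algAct k A 1 = 1
      rw [map_one, map_one, one_mul]
    exact LinearMap.congr_fun h a
  mul_one a := leftMul_one a
  left_distrib a b c := map_add (leftMul k A a) b c
  right_distrib a b c := LinearMap.congr_fun (map_add (leftMul k A) a b) c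
  zero_mul a := LinearMap.congr_fun (map_zero (leftMul k A)) a
  mul_zero a := map_zero (leftMul k A a)

instance : Algebra k (DrinfeldDouble k A) :=
  Algebra.ofModule (fun r a b => LinearMap.congr_fun (map_smul (leftMul k A) r a) b)
    (fun r a b => map_smul (leftMul k A a) r b)

variable (k A) in
/-- The identity map `D(A) = A° ⊗ A`. -/
def toTensor : DrinfeldDouble k A ≃ₗ[k] CoopDual k A ⊗[k] A := LinearEquiv.refl k _

variable (k A) in
/-- The inclusion of `A°` into the double. -/
def ofDual : CoopDual k A →ₐ[k] DrinfeldDouble k A :=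
  AlgHom.ofLinearMap ((TensorProduct.mk k (CoopDual k A) A).flip 1) rfl fun l m => by
    change (l * m) ⊗ₜ[k] (1 : A) = dualMulHom k A l (algAct k A 1 (m ⊗ₜ 1))
    rw [map_one]; rfl

variable (k A) in
/-- The inclusion of `A` into the double. -/
def ofAlg : A →ₐ[k] DrinfeldDouble k A :=
  AlgHom.ofLinearMap (TensorProduct.mk k (CoopDual k A) A 1) rfl fun y z => by
    change (1 : CoopDual k A) ⊗ₜ[k] (y * z) = dualMulHom k A 1 (algAct k A y (1 ⊗ₜ z))
    rw [map_one, algAct_unit]; rfl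

lemma ofDual_mul_ofAlg (l : CoopDual k A) (y : A) :
    ofDual k A l * ofAlg k A y = (toTensor k A).symm (l ⊗ₜ y) := by
  change dualMulHom k A l (algAct k A 1 (1 ⊗ₜ y)) = l ⊗ₜ y
  rw [algAct_unit, dualMulHom_tmul, mul_one, one_mul]

lemma induction_on {p : DrinfeldDouble k A → Prop} (s : DrinfeldDouble k A)
    (h : ∀ l y, p (ofDual k A l * ofAlg k A y)) (hadd : ∀ a b, p a → p b → p (a + b)) : p s := by
  have : ∀ t : CoopDual k A ⊗[k] A, p ((toTensor k A).symm t) := by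
    intro t
    induction t with
    | zero =>
      have := h 0 0
      rwa [map_zero, zero_mul] at this
    | add a b ha hb => rw [map_add]; exact hadd _ _ ha hb
    | tmul l y => rw [← ofDual_mul_ofAlg]; exact h l y
  exact this s

lemma matched_ofDual_ofAlg : Matched (ofDual k A) (ofAlg k A) := by
  let Φ : DrinfeldDouble k A →ₐ[k] Module.End k (CoopDual k A ⊗[k] A) :=
    AlgHom.ofLinearMap (leftMul k A)
      (by change dualMulHom k A 1 * algAct k A 1 = 1; rw [map_one, map_one, one_mul])
      fun a b => combine_combine (matched_self (k := k) (A := A)) a b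
  have hinj : Function.Injective Φ := fun a b h => by
    rw [← leftMul_one a, ← leftMul_one b]
    exact LinearMap.congr_fun h _
  have hI : ∀ l, Φ (ofDual k A l) = dualMulHom k A l := fun l => by
    change dualMulHom k A l * algAct k A 1 = _
    rw [map_one, mul_one]
  have hJ : ∀ l, Φ (ofAlg k A l) = algAct k A l := fun l => by
    change dualMulHom k A 1 * algAct k A l = _
    rw [map_one, one_mul]
  intro l
  apply WithConv.ext; ext1 y
  apply hinj
  have := congrArg (fun f : WithConv (A →ₗ[k] Module.End k (CoopDual k A ⊗[k] A)) => f y)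
    (matched_self l)
  simp only [conv_mul_apply] at this ⊢
  rw [map_sum, map_sum]
  simp only [map_mul]
  refine Eq.trans ?_ (this.trans ?_)
  · refine Finset.sum_congr rfl fun i _ => ?_
    exact congrArg₂ (· * ·) (hJ _) (hI _)
  · refine Finset.sum_congr rfl fun i _ => ?_
    exact (congrArg₂ (· * ·) (hI _) (hJ _)).symm

section Lift
variable {B : Type*} [Semiring B] [Algebra k B]

/-- A matched pair of homomorphisms from `A°` and `A` extends to the double. -/
def lift (I : CoopDual k A →ₐ[k] B) (J : A →ₐ[k] B) (h : Matched I J) :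
    DrinfeldDouble k A →ₐ[k] B :=
  AlgHom.ofLinearMap (combine I J ∘ₗ (toTensor k A).toLinearMap)
    (by change I 1 * J 1 = 1; simp) fun a b => combine_combine h a b

lemma lift_apply (I : CoopDual k A →ₐ[k] B) (J : A →ₐ[k] B) (h : Matched I J)
    (l : CoopDual k A) (y : A) : lift I J h (ofDual k A l * ofAlg k A y) = I l * J y := by
  rw [ofDual_mul_ofAlg]; rfl

lemma lift_ofDual (I : CoopDual k A →ₐ[k] B) (J : A →ₐ[k] B) (h : Matched I J)
    (l : CoopDual k A) : lift I J h (ofDual k A l) = I l := by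
  have := lift_apply I J h l 1
  simpa using this

lemma lift_ofAlg (I : CoopDual k A →ₐ[k] B) (J : A →ₐ[k] B) (h : Matched I J)
    (y : A) : lift I J h (ofAlg k A y) = J y := by
  have := lift_apply I J h 1 y
  simpa using this

lemma algHom_ext {f g : DrinfeldDouble k A →ₐ[k] B}
    (h1 : ∀ l, f (ofDual k A l) = g (ofDual k A l)) (h2 : ∀ y, f (ofAlg k A y) = g (ofAlg k A y)) :
    f = g := by
  ext s
  induction s using induction_on with
  | h l y => rw [map_mul, map_mul, h1, h2]
  | hadd a b ha hb => rw [map_add, map_add, ha, hb]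
end Lift

variable [FiniteDimensional k A]

variable (k A) in
/-- The comultiplication on `A°`, with values in the tensor square of the double. -/
def comulDual : CoopDual k A →ₐ[k] DrinfeldDouble k A ⊗[k] DrinfeldDouble k A :=
  (Algebra.TensorProduct.map (ofDual k A) (ofDual k A)).comp (Bialgebra.comulAlgHom k _)

variable (k A) in
/-- The comultiplication on `A`, with values in the tensor square of the double. -/
def comulAlg : A →ₐ[k] DrinfeldDouble k A ⊗[k] DrinfeldDouble k A :=
  (Algebra.TensorProduct.map (ofAlg k A) (ofAlg k A)).comp (Bialgebra.comulAlgHom k _)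

lemma matched_comul : Matched (comulDual k A) (comulAlg k A) := by
  set i₁ : CoopDual k A →ₐ[k] DrinfeldDouble k A ⊗[k] DrinfeldDouble k A :=
    Algebra.TensorProduct.includeLeft.comp (ofDual k A) with hi₁
  set i₂ : CoopDual k A →ₐ[k] DrinfeldDouble k A ⊗[k] DrinfeldDouble k A :=
    Algebra.TensorProduct.includeRight.comp (ofDual k A) with hi₂
  set j₁ : A →ₐ[k] DrinfeldDouble k A ⊗[k] DrinfeldDouble k A :=
    Algebra.TensorProduct.includeLeft.comp (ofAlg k A) with hj₁
  set j₂ : A →ₐ[k] DrinfeldDouble k A ⊗[k] DrinfeldDouble k A :=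
    Algebra.TensorProduct.includeRight.comp (ofAlg k A) with hj₂
  have m₁ : Matched i₁ j₁ := matched_comp matched_ofDual_ofAlg _
  have m₂ : Matched i₂ j₂ := matched_comp matched_ofDual_ofAlg _
  have hJ : toConv (comulAlg k A).toLinearMap = toConv j₁.toLinearMap * toConv j₂.toLinearMap := by
    apply WithConv.ext; ext1 y
    rw [conv_mul_apply]
    change Algebra.TensorProduct.map (ofAlg k A) (ofAlg k A) (comul y) = _
    rw [← (ℛ k y).eq, map_sum]
    refine Finset.sum_congr rfl fun i _ => ?_
    simp [hj₁, hj₂]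
  have hii : ∀ l m, Algebra.TensorProduct.map (ofDual k A) (ofDual k A) (l ⊗ₜ m) = i₁ l * i₂ m := by
    intro l m; simp [hi₁, hi₂]
  have c₁ : ∀ (m : CoopDual k A), toConv j₂.toLinearMap * cst k A (i₁ m) =
      cst k A (i₁ m) * toConv j₂.toLinearMap := by
    intro m
    apply WithConv.ext; ext1 y
    rw [mul_cst, cst_mul]
    simp [hi₁, hj₂]
  have c₂ : ∀ (m : CoopDual k A), toConv j₁.toLinearMap * cst k A (i₂ m) =
      cst k A (i₂ m) * toConv j₁.toLinearMap := by
    intro m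
    apply WithConv.ext; ext1 y
    rw [mul_cst, cst_mul]
    simp [hi₂, hj₁]
  intro l
  set r := ℛ k l
  have hR : transR (comulDual k A) l =
      ∑ p ∈ r.index, cst k A (i₁ (r.left p)) * transR i₂ (r.right p) := by
    apply WithConv.ext; ext1 y
    rw [WithConv.ofConv_sum, LinearMap.sum_apply]
    simp_rw [cst_mul, transR_apply]
    change Algebra.TensorProduct.map (ofDual k A) (ofDual k A) (comul (actR y l)) = _
    rw [comul_actR, ← r.eq]
    simp [hii]
  have hL : transL (comulDual k A) l =
      ∑ p ∈ r.index, transL i₁ (r.left p) * cst k A (i₂ (r.right p)) := by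
    apply WithConv.ext; ext1 y
    rw [WithConv.ofConv_sum, LinearMap.sum_apply]
    simp_rw [mul_cst, transL_apply]
    change Algebra.TensorProduct.map (ofDual k A) (ofDual k A) (comul (actL y l)) = _
    rw [comul_actL, ← r.eq]
    simp [hii]
  have hB : ∑ p ∈ r.index, cst k A (i₁ (r.left p)) * transL i₂ (r.right p) =
      ∑ p ∈ r.index, transR i₁ (r.left p) * cst k A (i₂ (r.right p)) := by
    apply WithConv.ext; ext1 y
    rw [WithConv.ofConv_sum, LinearMap.sum_apply, WithConv.ofConv_sum, LinearMap.sum_apply]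
    simp_rw [mul_cst, cst_mul, transL_apply, transR_apply, ← hii, ← map_sum]
    have := comul_balanced y l
    rw [← r.eq] at this
    simp only [map_sum, LinearMap.lTensor_tmul, LinearMap.rTensor_tmul] at this
    rw [this]
  rw [hJ, hR, hL]
  calc _ = toConv j₁.toLinearMap *
        (∑ p ∈ r.index, cst k A (i₁ (r.left p)) * transL i₂ (r.right p)) *
          toConv j₂.toLinearMap := by
        rw [mul_assoc, mul_assoc, Finset.sum_mul, Finset.mul_sum]
        congr 1
        refine Finset.sum_congr rfl fun p _ => ?_
        rw [← mul_assoc, c₁, mul_assoc, m₂, mul_assoc]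
    _ = _ := by
        rw [hB, Finset.mul_sum, Finset.sum_mul, Finset.sum_mul]
        refine Finset.sum_congr rfl fun p _ => ?_
        rw [← mul_assoc _ (transR i₁ _), m₁, mul_assoc (transL i₁ _), c₂]
        simp only [mul_assoc]

variable (k A) in
/-- The counit of `A°`. -/
def counitDual : CoopDual k A →ₐ[k] k := Bialgebra.counitAlgHom k _

variable (k A) in
/-- The comultiplication of the double: it extends those of `A°` and `A` multiplicatively. -/
def comulHom : DrinfeldDouble k A →ₐ[k] DrinfeldDouble k A ⊗[k] DrinfeldDouble k A :=
  lift (comulDual k A) (comulAlg k A) matched_comul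

lemma matched_counit : Matched (counitDual k A) (Bialgebra.counitAlgHom k A) := by
  intro l
  have h : toConv (Bialgebra.counitAlgHom k A).toLinearMap = (1 : WithConv (A →ₗ[k] k)) := rfl
  rw [h, one_mul, mul_one]
  apply WithConv.ext; ext1 y
  rw [transR_apply, transL_apply]
  change (actR y l) 1 = (actL y l) 1
  rw [actR_apply, actL_apply, mul_one, one_mul]

variable (k A) in
/-- The counit of the double. -/
def counitHom : DrinfeldDouble k A →ₐ[k] k :=
  lift (counitDual k A) (Bialgebra.counitAlgHom k A) matched_counit

lemma comulHom_ofDual (l : CoopDual k A) : comulHom k A (ofDual k A l) =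
    Algebra.TensorProduct.map (ofDual k A) (ofDual k A) (comul (R := k) l) :=
  lift_ofDual _ _ _ l

lemma comulHom_ofAlg (y : A) : comulHom k A (ofAlg k A y) =
    Algebra.TensorProduct.map (ofAlg k A) (ofAlg k A) (comul (R := k) y) :=
  lift_ofAlg _ _ _ y

lemma counitHom_ofDual (l : CoopDual k A) :
    counitHom k A (ofDual k A l) = counit (R := k) l :=
  lift_ofDual _ _ _ l

lemma counitHom_ofAlg (y : A) : counitHom k A (ofAlg k A y) = counit (R := k) y :=
  lift_ofAlg _ _ _ y

section Axioms
variable {H : Type*} [Ring H] [Bialgebra k H] (f : H →ₐ[k] DrinfeldDouble k A)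

lemma coassoc_on (hf : ∀ x, comulHom k A (f x) =
      Algebra.TensorProduct.map f f (comul (R := k) x)) (x : H) :
    Algebra.TensorProduct.assoc k k k _ _ _
      (Algebra.TensorProduct.map (comulHom k A) (.id k _) (comulHom k A (f x))) =
    Algebra.TensorProduct.map (.id k _) (comulHom k A) (comulHom k A (f x)) := by
  let F : H ⊗[k] (H ⊗[k] H) →ₐ[k]
      DrinfeldDouble k A ⊗[k] (DrinfeldDouble k A ⊗[k] DrinfeldDouble k A) :=
    Algebra.TensorProduct.map f (Algebra.TensorProduct.map f f)
  have h1 : ∀ t : H ⊗[k] H, Algebra.TensorProduct.assoc k k k _ _ _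
      (Algebra.TensorProduct.map (comulHom k A) (.id k _)
        (Algebra.TensorProduct.map f f t)) =
      F (TensorProduct.assoc k H H H ((comul (R := k) (A := H)).rTensor H t)) := by
    intro t
    induction t with
    | zero => simp
    | add a b ha hb => simp only [map_add, ha, hb]
    | tmul a b =>
      simp only [Algebra.TensorProduct.map_tmul, LinearMap.rTensor_tmul, hf]
      generalize comul (R := k) a = s
      induction s with
      | zero => simp
      | add a b ha hb => simp only [map_add, TensorProduct.add_tmul, ha, hb]
      | tmul c d => simp [F]
  have h2 : ∀ t : H ⊗[k] H, Algebra.TensorProduct.map (.id k _) (comulHom k A)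
        (Algebra.TensorProduct.map f f t) =
      F ((comul (R := k) (A := H)).lTensor H t) := by
    intro t
    induction t with
    | zero => simp
    | add a b ha hb => simp only [map_add, ha, hb]
    | tmul a b => simp [F, hf]
  rw [hf, h1, h2, Coalgebra.coassoc_apply]

lemma rTensor_on (hf : ∀ x, comulHom k A (f x) =
      Algebra.TensorProduct.map f f (comul (R := k) x))
    (hc : ∀ x, counitHom k A (f x) = counit (R := k) x) (x : H) :
    Algebra.TensorProduct.map (counitHom k A) (.id k _) (comulHom k A (f x)) = 1 ⊗ₜ f x := by
  rw [hf, ← (ℛ k x).eq]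
  simp only [map_sum, Algebra.TensorProduct.map_tmul, hc, AlgHom.id_apply]
  exact sum_counit_tmul_map_eq f x

lemma lTensor_on (hf : ∀ x, comulHom k A (f x) =
      Algebra.TensorProduct.map f f (comul (R := k) x))
    (hc : ∀ x, counitHom k A (f x) = counit (R := k) x) (x : H) :
    Algebra.TensorProduct.map (.id k _) (counitHom k A) (comulHom k A (f x)) = f x ⊗ₜ 1 := by
  rw [hf, ← (ℛ k x).eq]
  simp only [map_sum, Algebra.TensorProduct.map_tmul, hc, AlgHom.id_apply]
  exact sum_map_tmul_counit_eq f x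
end Axioms

instance : Bialgebra k (DrinfeldDouble k A) :=
  Bialgebra.ofAlgHom (comulHom k A) (counitHom k A)
    (algHom_ext (fun l => coassoc_on (ofDual k A) comulHom_ofDual l)
      (fun y => coassoc_on (ofAlg k A) comulHom_ofAlg y))
    (algHom_ext (fun l => rTensor_on (ofDual k A) comulHom_ofDual counitHom_ofDual l)
      (fun y => rTensor_on (ofAlg k A) comulHom_ofAlg counitHom_ofAlg y))
    (algHom_ext (fun l => lTensor_on (ofDual k A) comulHom_ofDual counitHom_ofDual l)
      (fun y => lTensor_on (ofAlg k A) comulHom_ofAlg counitHom_ofAlg y))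

lemma comul_ofDual (l : CoopDual k A) : comul (R := k) (ofDual k A l) =
    TensorProduct.map (ofDual k A).toLinearMap (ofDual k A).toLinearMap (comul (R := k) l) :=
  comulHom_ofDual l

lemma comul_ofAlg (y : A) : comul (R := k) (ofAlg k A y) =
    TensorProduct.map (ofAlg k A).toLinearMap (ofAlg k A).toLinearMap (comul (R := k) y) :=
  comulHom_ofAlg y

lemma counit_ofDual (l : CoopDual k A) : counit (R := k) (ofDual k A l) = counit (R := k) l :=
  counitHom_ofDual l

lemma counit_ofAlg (y : A) : counit (R := k) (ofAlg k A y) = counit (R := k) y :=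
  counitHom_ofAlg y

variable (k A) in
/-- The antipode of the double: `S(l · y) = S(y) · S(l)`. -/
def antipodeMap : DrinfeldDouble k A →ₗ[k] DrinfeldDouble k A :=
  LinearMap.mul' k (DrinfeldDouble k A) ∘ₗ
    (TensorProduct.comm k (DrinfeldDouble k A) (DrinfeldDouble k A)).toLinearMap ∘ₗ
    TensorProduct.map ((ofDual k A).toLinearMap ∘ₗ antipode k)
      ((ofAlg k A).toLinearMap ∘ₗ antipode k) ∘ₗ
    (toTensor k A).toLinearMap

lemma antipodeMap_apply (l : CoopDual k A) (y : A) :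
    antipodeMap k A (ofDual k A l * ofAlg k A y) =
      ofAlg k A (antipode k y) * ofDual k A (antipode k l) := by
  rw [ofDual_mul_ofAlg]; rfl

lemma comul_mul_repr (l : CoopDual k A) (y : A) :
    comul (R := k) (ofDual k A l * ofAlg k A y) =
      ∑ i ∈ (ℛ k l).index, ∑ j ∈ (ℛ k y).index,
        (ofDual k A ((ℛ k l).left i) * ofAlg k A ((ℛ k y).left j)) ⊗ₜ[k]
          (ofDual k A ((ℛ k l).right i) * ofAlg k A ((ℛ k y).right j)) := by
  rw [Bialgebra.comul_mul, comul_ofDual, comul_ofAlg]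
  conv_lhs => rw [← (ℛ k l).eq, ← (ℛ k y).eq]
  simp only [map_sum, TensorProduct.map_tmul, Finset.sum_mul_sum,
    Algebra.TensorProduct.tmul_mul_tmul, AlgHom.toLinearMap_apply]

instance : HopfAlgebra k (DrinfeldDouble k A) where
  antipode := antipodeMap k A
  mul_antipode_rTensor_comul := by
    ext s
    induction s using induction_on with
    | hadd a b ha hb => rw [map_add, map_add, ha, hb]
    | h l y =>
      rw [LinearMap.comp_apply, LinearMap.comp_apply, comul_mul_repr]
      simp only [map_sum, LinearMap.rTensor_tmul, LinearMap.mul'_apply, antipodeMap_apply]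
      have h1 : ∀ i j, ofAlg k A (antipode k ((ℛ k y).left j)) *
          ofDual k A (antipode k ((ℛ k l).left i)) *
          (ofDual k A ((ℛ k l).right i) * ofAlg k A ((ℛ k y).right j)) =
          ofAlg k A (antipode k ((ℛ k y).left j)) *
          ofDual k A (antipode k ((ℛ k l).left i) * (ℛ k l).right i) *
          ofAlg k A ((ℛ k y).right j) := by
        intro i j; rw [map_mul]; simp only [mul_assoc]
      simp only [h1]
      rw [Finset.sum_comm]
      simp only [← Finset.sum_mul, ← Finset.mul_sum, ← map_sum, sum_antipode_mul_eq_smul]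
      simp only [map_smul, map_one, mul_smul_comm, mul_one, smul_mul_assoc, ← map_mul,
        ← Finset.smul_sum, ← map_sum, sum_antipode_mul_eq_smul]
      rw [LinearMap.comp_apply, Bialgebra.counit_mul, counit_ofDual, counit_ofAlg,
        Algebra.linearMap_apply, Algebra.algebraMap_eq_smul_one, smul_smul]
  mul_antipode_lTensor_comul := by
    ext s
    induction s using induction_on with
    | hadd a b ha hb => rw [map_add, map_add, ha, hb]
    | h l y =>
      rw [LinearMap.comp_apply, LinearMap.comp_apply, comul_mul_repr]
      simp only [map_sum, LinearMap.lTensor_tmul, LinearMap.mul'_apply, antipodeMap_apply]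
      have h1 : ∀ i j, ofDual k A ((ℛ k l).left i) * ofAlg k A ((ℛ k y).left j) *
          (ofAlg k A (antipode k ((ℛ k y).right j)) *
          ofDual k A (antipode k ((ℛ k l).right i))) =
          ofDual k A ((ℛ k l).left i) *
          ofAlg k A ((ℛ k y).left j * antipode k ((ℛ k y).right j)) *
          ofDual k A (antipode k ((ℛ k l).right i)) := by
        intro i j; rw [map_mul]; simp only [mul_assoc]
      simp only [h1]
      simp only [← Finset.sum_mul, ← Finset.mul_sum, ← map_sum, sum_mul_antipode_eq_smul]
      simp only [map_smul, map_one, mul_smul_comm, mul_one, smul_mul_assoc, ← map_mul,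
        ← Finset.smul_sum, ← map_sum, sum_mul_antipode_eq_smul]
      rw [LinearMap.comp_apply, Bialgebra.counit_mul, counit_ofDual, counit_ofAlg,
        Algebra.linearMap_apply, Algebra.algebraMap_eq_smul_one, smul_smul, mul_comm]

end DrinfeldDouble
end Double

/-! ### integrals and moduli -/
section Integrals

/-- `μ` is a left integral: `∑ h' μ(h'') = μ(h) 1`. -/
def IsLeftIntegral (μ : Module.Dual k A) : Prop :=
  ∀ h : A, TensorProduct.rid k A (μ.lTensor A (comul h)) = μ h • (1 : A)

variable (k) in
/-- `x` is a left cointegral: `h x = ε(h) x`. -/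
def IsLeftCointegral (x : A) : Prop :=
  ∀ h : A, h * x = counit (R := k) h • x

/-- `α` is the modulus of the left cointegral `x`: `x h = α(h) x`. -/
def IsModulus (x : A) (α : Module.Dual k A) : Prop :=
  ∀ h : A, x * h = α h • x

/-- `a` is the comodulus of the left integral `μ`: `∑ μ(h') h'' = μ(h) a`. -/
def IsComodulus (μ : Module.Dual k A) (a : A) : Prop :=
  ∀ h : A, TensorProduct.lid k A (μ.rTensor A (comul h)) = μ h • a

end Integrals

/-! ### balancings and the operators on the double -/
namespace DrinfeldDouble
variable [HasBijectiveAntipode k A]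

/-- The linear form `μ_D(l · y) = l(x) μ(S(y))`. -/
def integral (μ : Module.Dual k A) (x : A) : DrinfeldDouble k A →ₗ[k] k :=
  LinearMap.mul' k k ∘ₗ TensorProduct.map (evalAt k A x) (μ ∘ₗ antipode k) ∘ₗ
    (toTensor k A).toLinearMap

variable (k A) in
/-- The contraction `χ(l · y) = l(y)`. -/
def contraction : DrinfeldDouble k A →ₗ[k] k :=
  TensorProduct.lift (toDual k A).toLinearMap ∘ₗ (toTensor k A).toLinearMap

variable [FiniteDimensional k A] {ι : Type*} [Fintype ι] (e : Module.Basis ι k A)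

/-- The basis element `e_i` of `A` inside the double. -/
def basisElt (i : ι) : DrinfeldDouble k A := ofAlg k A (e i)

/-- The dual basis element `f_i` of `A°` inside the double. -/
def dualElt (i : ι) : DrinfeldDouble k A := ofDual k A ((toDual k A).symm (e.coord i))

/-- `u = ∑ S(f_i) e_i`. -/
def canonicalU : DrinfeldDouble k A :=
  ∑ i, antipode k (dualElt e i) * basisElt e i

/-- `û = ∑ S²(e_i) f_i`. -/
def canonicalUHat : DrinfeldDouble k A :=
  ∑ i, antipode k (antipode k (basisElt e i)) * dualElt e i

/-- A balancing: a group-like `κ` with `κ² = g`, where `g = u û`, and `S²(y) = κ y κ⁻¹`. -/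
def IsBalancing (κ : GroupLike k (DrinfeldDouble k A)) : Prop :=
  (κ : DrinfeldDouble k A) ^ 2 = canonicalU e * canonicalUHat e ∧
    ∀ y : DrinfeldDouble k A,
      antipode k (antipode k y) = (κ : DrinfeldDouble k A) * y * ((κ⁻¹ : GroupLike k _) : _)

/-- The ribbon element `v = u κ⁻¹` of a balancing `κ`. -/
def ribbon (κ : GroupLike k (DrinfeldDouble k A)) : DrinfeldDouble k A :=
  canonicalU e * ((κ⁻¹ : GroupLike k (DrinfeldDouble k A)) : DrinfeldDouble k A)

/-- The number `ν` with `ν⁻¹ = χ(κ)`. -/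
def nu (κ : GroupLike k (DrinfeldDouble k A)) : k :=
  (contraction k A (κ : DrinfeldDouble k A))⁻¹

/-- The operator `S(X) = ∑ μ_D(X f_j e_i) S(f_i) S(e_j)`. -/
def opS (μ : Module.Dual k A) (x : A) : DrinfeldDouble k A →ₗ[k] DrinfeldDouble k A :=
  ∑ i, ∑ j, (integral μ x ∘ₗ LinearMap.mulRight k (dualElt e j * basisElt e i)).smulRight
    (antipode k (dualElt e i) * antipode k (basisElt e j))

end DrinfeldDouble

end

end HopfDouble

end

/-!
The modular relation for the operators `S` and `T` on the Drinfeld double of a finite dimensional Hopf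
algebra with a balancing.
-/

noncomputable section

namespace HopfDouble

open scoped TensorProduct
open Coalgebra HopfAlgebra WithConv

/-! ### Convolution identities and right integrals in a Hopf algebra -/

section General
variable {k H : Type*} [Field k] [Ring H] [HopfAlgebra k H]

/-! The relation splits into an identity valid in any Hopf algebra with an R-matrix, a balancing and
a right integral `λ`, and the evaluation of one scalar on the double.

Let R = ∑ e_i ⊗ f_i, M = R₂₁R, and let v = uκ⁻¹. The element v is central, S(v) = v, and M = (v ⊗
v)Δ(v⁻¹). The operator is 𝒮(X) = S((λ(X·) ⊗ id)M). Insert the formula for M into the outer 𝒮 of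
𝒮𝒯⁻¹𝒮: invariance of λ turns it into a coproduct of the inner contraction. The hexagon identities
give (id ⊗ Δ)M = R₂₁M₁₃R₁₂, and contracting the third leg of M₁₃ leaves λ(v⁻¹)v, again by
invariance. What remains is λ(v⁻¹)𝒯𝒮𝒯. This is `IsBalancingElt.transformS_relation`. It applies to
the double because the canonical element is an R-matrix (`isUniversalR`) and μ_D is a right integral
(`isRightIntegral_integral`).

For the scalar, a group-like κ of D(A) factors as κ = l·g with l a character of A and g group-like
in A, so that ν⁻¹ = l(g). Evaluating the commutation relation of the double at (μ, x) yields S(ua) =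
S(α)u (`antipode_canonicalU_mul`); with κ²S(u) = u this gives κ² = αa⁻¹, hence l² = α and g²a = 1
(`sq_eq_modulus`). Therefore l(a) = ν² and α(a) = ν⁴. Finally, μ_D(v⁻¹) equals μ(S(S²(x_l)g)) for
the translate x_l = ∑ l(x')x''. Both one-sided actions on x_l are by characters, and three uses of ∑
μ(S(h)x')x'' = ha evaluate it as l(g)l(a)³ = ν⁻¹ν⁶ = ν⁵ (`integral_ribbonInv`). -/

lemma conv_apply_ext {C : Type*} [Semiring C] [Algebra k C] {f g : WithConv (H →ₗ[k] C)}
    (h : f = g) (y : H) : f y = g y := by rw [h]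

-- Factoring Δ into the two inclusions makes its convolution inverse explicit.
variable (k H) in
lemma comul_eq_conv : toConv (comul (R := k) (A := H)) =
    toConv (Algebra.TensorProduct.includeLeft (S := k) (R := k) (A := H) (B := H)).toLinearMap *
      toConv (Algebra.TensorProduct.includeRight (R := k) (A := H) (B := H)).toLinearMap := by
  apply WithConv.ext; ext1 y
  rw [conv_mul_apply]
  simp [(ℛ k y).eq]

/-- `f ∘ S` is the convolution inverse of an algebra homomorphism `f`. -/
lemma conv_antipode_mul {C : Type*} [Semiring C] [Algebra k C] (f : H →ₐ[k] C) :
    toConv (f.toLinearMap ∘ₗ antipode k) * toConv f.toLinearMap = 1 := by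
  apply WithConv.ext; ext1 y
  rw [conv_mul_apply]
  simp only [LinearMap.comp_apply, AlgHom.toLinearMap_apply, ← map_mul, ← map_sum,
    sum_antipode_mul_eq_smul]
  simp [Algebra.algebraMap_eq_smul_one]

lemma conv_mul_antipode {C : Type*} [Semiring C] [Algebra k C] (f : H →ₐ[k] C) :
    toConv f.toLinearMap * toConv (f.toLinearMap ∘ₗ antipode k) = 1 := by
  apply WithConv.ext; ext1 y
  rw [conv_mul_apply]
  simp only [LinearMap.comp_apply, AlgHom.toLinearMap_apply, ← map_mul, ← map_sum,
    sum_mul_antipode_eq_smul]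
  simp [Algebra.algebraMap_eq_smul_one]

/-- Both sides are convolution inverses of Δ: Δ ∘ S is a left inverse because Δ is an algebra map,
and the flipped expression is a right inverse by `comul_eq_conv`. -/
lemma comul_antipode (y : H) : comul (R := k) (antipode k y) =
    TensorProduct.map (antipode k) (antipode k) (TensorProduct.comm k H H (comul (R := k) y)) := by
  let i₁ : H →ₐ[k] H ⊗[k] H := Algebra.TensorProduct.includeLeft
  let i₂ : H →ₐ[k] H ⊗[k] H := Algebra.TensorProduct.includeRight
  have h1 : toConv (comul (R := k) (A := H)) *
      (toConv (i₂.toLinearMap ∘ₗ antipode k) * toConv (i₁.toLinearMap ∘ₗ antipode k)) = 1 := by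
    rw [comul_eq_conv, mul_assoc, ← mul_assoc (toConv i₂.toLinearMap), conv_mul_antipode, one_mul,
      conv_mul_antipode]
  have h2 : toConv (comul (R := k) (A := H) ∘ₗ antipode k) *
      toConv (comul (R := k) (A := H)) = 1 :=
    conv_antipode_mul (Bialgebra.comulAlgHom k H)
  have h3 := left_inv_eq_right_inv h2 h1
  refine (conv_apply_ext h3 y).trans ?_
  rw [conv_mul_apply, ← (ℛ k y).eq]
  simp [i₁, i₂]

/-- `lam` is a right integral: `∑ λ(h') h'' = λ(h) 1`. -/
def IsRightIntegral (lam : H →ₗ[k] k) : Prop :=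
  ∀ h : H, TensorProduct.lid k H (lam.rTensor H (comul h)) = lam h • (1 : H)

/-- The contraction `λ ⊗ id`. -/
def contractLeft (lam : H →ₗ[k] k) : H ⊗[k] H →ₗ[k] H :=
  (TensorProduct.lid k H).toLinearMap ∘ₗ lam.rTensor H

/-- The contraction `id ⊗ λ`. -/
def contractRight (lam : H →ₗ[k] k) : H ⊗[k] H →ₗ[k] H :=
  (TensorProduct.rid k H).toLinearMap ∘ₗ lam.lTensor H

@[simp] lemma contractLeft_tmul (lam : H →ₗ[k] k) (a b : H) :
    contractLeft lam (a ⊗ₜ b) = lam a • b := by simp [contractLeft]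

@[simp] lemma contractRight_tmul (lam : H →ₗ[k] k) (a b : H) :
    contractRight lam (a ⊗ₜ b) = lam b • a := by simp [contractRight]

lemma contractLeft_mul (lam : H →ₗ[k] k) (t : H ⊗[k] H) (a b : H) :
    contractLeft lam (a ⊗ₜ b * t) = b * contractLeft (lam ∘ₗ LinearMap.mulLeft k a) t := by
  induction t with
  | zero => simp
  | add x y hx hy => simp only [mul_add, map_add, hx, hy]
  | tmul c d => simp

lemma contractRight_mul (lam : H →ₗ[k] k) (t : H ⊗[k] H) (a b : H) :
    contractRight lam (a ⊗ₜ b * t) = a * contractRight (lam ∘ₗ LinearMap.mulLeft k b) t := by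
  induction t with
  | zero => simp
  | add x y hx hy => simp only [mul_add, map_add, hx, hy]
  | tmul c d => simp

/-- `∑ λ(S(b) w') w'' = ∑ λ(S(b'') w) b'` for a right integral `λ`. -/
lemma IsRightIntegral.shift {lam : H →ₗ[k] k} (hl : IsRightIntegral lam) (b w : H) :
    contractLeft (lam ∘ₗ LinearMap.mulLeft k (antipode k b)) (comul w) =
      contractRight (lam ∘ₗ LinearMap.mulRight k w ∘ₗ antipode k) (comul b) := by
  have hl' : ∀ h : H, contractLeft lam (comul h) = lam h • (1 : H) := hl
  let φ : WithConv (H →ₗ[k] H) := toConv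
    { toFun := fun c => contractLeft (lam ∘ₗ LinearMap.mulLeft k (antipode k c)) (comul w)
      map_add' := fun c d => by
        conv_lhs => rw [← (ℛ k w).eq]
        conv_rhs => rw [← (ℛ k w).eq]
        simp [add_mul, add_smul, Finset.sum_add_distrib]
      map_smul' := fun c d => by
        conv_lhs => rw [← (ℛ k w).eq]
        conv_rhs => rw [← (ℛ k w).eq]
        simp [Finset.smul_sum, mul_smul] }
  let ψ : WithConv (H →ₗ[k] H) :=
    toConv ((lam ∘ₗ LinearMap.mulRight k w ∘ₗ antipode k).smulRight (1 : H))
  have hφ : ∀ c, φ c = contractLeft (lam ∘ₗ LinearMap.mulLeft k (antipode k c)) (comul w) :=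
    fun _ => rfl
  have hψ : ∀ c, ψ c = lam (antipode k c * w) • (1 : H) := fun _ => rfl
  -- This is invariance of λ at S(c)w, using Δ(S(c)) = S(c'') ⊗ S(c'). Convolving with the identity
  -- on the left then removes the antipode and isolates φ.
  have h1 : toConv (antipode k (A := H)) * φ = ψ := by
    apply WithConv.ext; ext1 c
    change (toConv (antipode k (A := H)) * φ) c = ψ c
    rw [hψ, ← hl', Bialgebra.comul_mul, comul_antipode, conv_mul_apply]
    conv_rhs => rw [← (ℛ k c).eq]
    simp only [map_sum, TensorProduct.comm_tmul, TensorProduct.map_tmul, Finset.sum_mul,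
      contractLeft_mul, hφ]
  have h2 : φ = toConv LinearMap.id * ψ := by
    rw [← h1, ← mul_assoc, LinearMap.id_mul_antipode, one_mul]
  rw [← hφ, h2, conv_mul_apply, ← (ℛ k b).eq]
  simp [hψ]

/-- `∑ h' λ(S(h'')) = λ(S(h)) 1` for a right integral `λ`. -/
lemma IsRightIntegral.comp_antipode {lam : H →ₗ[k] k} (hl : IsRightIntegral lam)
    (hS : Function.Injective (antipode k : H →ₗ[k] H)) (h : H) :
    contractRight (lam ∘ₗ antipode k) (comul h) = lam (antipode k h) • (1 : H) := by
  -- After applying S, the left side is (λ ⊗ id)Δ(S(h)), where invariance applies directly.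
  apply hS
  have := hl (antipode k h)
  rw [comul_antipode] at this
  rw [map_smul, antipode_one, ← this, ← (ℛ k h).eq]
  simp

end General

/-! ### R-matrices and the Drinfeld element -/

section Universal
variable {k H : Type*} [Field k] [Ring H] [HopfAlgebra k H] {ι : Type*} [Fintype ι]

variable (k) in
/-- The families `e`, `f` make `R = ∑ e_i ⊗ f_i` a universal `R`-matrix. -/
structure IsUniversalR (e f : ι → H) : Prop where
  mul_comul : ∀ y : H, (∑ i, e i ⊗ₜ[k] f i) * comul y =
    TensorProduct.comm k H H (comul y) * ∑ i, e i ⊗ₜ[k] f i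
  comul_left : ∑ i, comul (R := k) (e i) ⊗ₜ[k] f i =
    ∑ p, ∑ q, (e p ⊗ₜ[k] e q) ⊗ₜ[k] (f p * f q)
  comul_right : ∑ i, comul (R := k) (f i) ⊗ₜ[k] e i =
    ∑ p, ∑ q, (f p ⊗ₜ[k] f q) ⊗ₜ[k] (e q * e p)
  counit_left : ∑ i, counit (R := k) (e i) • f i = 1
  antipode_antipode : ∑ i, antipode k (e i) ⊗ₜ[k] antipode k (f i) = ∑ i, e i ⊗ₜ[k] f i

variable (k) in
/-- The element `∑ S(f_i) e_i`. -/
def drinfeldElt (e f : ι → H) : H := ∑ i, antipode k (f i) * e i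

variable (k) in
/-- The element `∑ f_i S²(e_i)`, inverse to `drinfeldElt`. -/
def drinfeldInv (e f : ι → H) : H := ∑ i, f i * antipode k (antipode k (e i))

namespace IsUniversalR
variable {e f : ι → H} (h : IsUniversalR k e f) {P : Type*} [Ring P] [Algebra k P]
include h

lemma comul_left_map (g : H →ₗ[k] P) (F : H ⊗[k] H →ₗ[k] P) :
    ∑ i, g (f i) * F (comul (e i)) = ∑ p, ∑ q, g (f p * f q) * F (e p ⊗ₜ e q) := by
  have := congrArg (LinearMap.mul' k P ∘ₗ (TensorProduct.comm k P P).toLinearMap ∘ₗ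
    TensorProduct.map F g) h.comul_left
  simpa only [map_sum, LinearMap.comp_apply, TensorProduct.map_tmul, LinearEquiv.coe_coe,
    TensorProduct.comm_tmul, LinearMap.mul'_apply] using this

lemma comul_right_map (F : H ⊗[k] H →ₗ[k] P) (g : H →ₗ[k] P) :
    ∑ i, F (comul (f i)) * g (e i) = ∑ p, ∑ q, F (f p ⊗ₜ f q) * g (e q * e p) := by
  have := congrArg (LinearMap.mul' k P ∘ₗ TensorProduct.map F g) h.comul_right
  simpa only [map_sum, LinearMap.comp_apply, TensorProduct.map_tmul,
    LinearMap.mul'_apply] using this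

lemma antipode_map (F : H ⊗[k] H →ₗ[k] P) :
    ∑ i, F (antipode k (e i) ⊗ₜ antipode k (f i)) = ∑ i, F (e i ⊗ₜ f i) := by
  simpa only [map_sum] using congrArg F h.antipode_antipode

lemma counit_map (g : H →ₗ[k] P) : ∑ i, counit (R := k) (e i) • g (f i) = g 1 := by
  simpa only [map_sum, map_smul] using congrArg g h.counit_left

/-- `S²(y) u = u y`. -/
lemma drinfeldElt_mul (y : H) :
    drinfeldElt k e f * y = antipode k (antipode k y) * drinfeldElt k e f := by
  set u := drinfeldElt k e f with hu
  -- Values are taken in the opposite algebra so that ∑ S(z'')uz', with its reversed order of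
  -- factors, becomes a convolution product.
  let J : WithConv (H →ₗ[k] Hᵐᵒᵖ) := toConv (MulOpposite.opLinearEquiv k).toLinearMap
  let J₁ : WithConv (H →ₗ[k] Hᵐᵒᵖ) :=
    toConv ((MulOpposite.opLinearEquiv k).toLinearMap ∘ₗ antipode k)
  let J₂ : WithConv (H →ₗ[k] Hᵐᵒᵖ) :=
    toConv ((MulOpposite.opLinearEquiv k).toLinearMap ∘ₗ antipode k ∘ₗ antipode k)
  -- Applying a ⊗ b ↦ S(b)a to RΔ(z) = Δ'(z)R gives ∑ S(z'')uz' = ε(z)u. The map `J₂` is the inverse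
  -- of `J₁` and moves S to the other side as S².
  have h1 : J * cst k H (MulOpposite.op u) * J₁ = cst k H (MulOpposite.op u) := by
    apply WithConv.ext; ext1 z
    rw [conv_mul_apply]
    simp only [mul_cst]
    apply MulOpposite.unop_injective
    let θ : H ⊗[k] H →ₗ[k] H := LinearMap.mul' k H ∘ₗ (TensorProduct.comm k H H).toLinearMap ∘ₗ
      (antipode k).lTensor H
    have hθ : ∀ a b, θ (a ⊗ₜ b) = antipode k b * a := fun _ _ => rfl
    have := congrArg θ (h.mul_comul z)
    rw [← (ℛ k z).eq] at this
    simp only [map_sum, TensorProduct.comm_tmul, Finset.sum_mul_sum,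
      Algebra.TensorProduct.tmul_mul_tmul, hθ, antipode_mul_antidistrib] at this
    rw [Finset.sum_comm] at this
    have e1 : ∀ i, ∑ j, antipode k ((ℛ k z).right i) * antipode k (f j) *
        (e j * (ℛ k z).left i) = antipode k ((ℛ k z).right i) * (u * (ℛ k z).left i) := by
      intro i
      simp only [hu, drinfeldElt, Finset.sum_mul, Finset.mul_sum, mul_assoc]
    have e2 : ∑ i ∈ (ℛ k z).index, ∑ j, antipode k (f j) * antipode k ((ℛ k z).left i) *
        ((ℛ k z).right i * e j) = counit (R := k) z • u := by
      rw [Finset.sum_comm]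
      simp only [hu, drinfeldElt, Finset.smul_sum]
      refine Finset.sum_congr rfl fun j _ => ?_
      have : ∀ i, antipode k (f j) * antipode k ((ℛ k z).left i) * ((ℛ k z).right i * e j) =
          antipode k (f j) * (antipode k ((ℛ k z).left i) * (ℛ k z).right i) * e j := by
        intro i; simp only [mul_assoc]
      simp only [this, ← Finset.sum_mul, ← Finset.mul_sum, sum_antipode_mul_eq_smul]
      simp
    simp only [e1, e2] at this
    simpa [J, J₁, cst] using this
  have h2 : J₁ * J₂ = 1 := by
    apply WithConv.ext; ext1 z
    rw [conv_mul_apply]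
    apply MulOpposite.unop_injective
    have := congrArg (antipode k) (sum_mul_antipode_eq_smul (R := k) (ℛ k z))
    simpa [J₁, J₂, antipode_mul_antidistrib, Algebra.algebraMap_eq_smul_one] using this
  have h3 : J * cst k H (MulOpposite.op u) = cst k H (MulOpposite.op u) * J₂ := by
    calc _ = J * cst k H (MulOpposite.op u) * (J₁ * J₂) := by rw [h2, mul_one]
      _ = _ := by rw [← mul_assoc, h1]
  have h4 := conv_apply_ext h3 y
  rw [mul_cst, cst_mul] at h4
  exact MulOpposite.op_injective h4

/-- Moving u past f_i produces S²(f_i)uS²(e_i), and (S ⊗ S)R = R lowers this to S(f_i)uS(e_i).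
Expanding u gives ∑ S(f_j f_i)e_jS(e_i), which the coproduct of the first leg of R collapses to ∑
S(f_i)ε(e_i) = 1. -/
lemma drinfeldElt_mul_inv : drinfeldElt k e f * drinfeldInv k e f = 1 := by
  rw [drinfeldInv, Finset.mul_sum]
  have h2 : ∀ i, drinfeldElt k e f * (f i * antipode k (antipode k (e i))) =
      (LinearMap.mul' k H ∘ₗ (TensorProduct.comm k H H).toLinearMap ∘ₗ
        TensorProduct.map (antipode k)
        ((LinearMap.mulRight k (drinfeldElt k e f)) ∘ₗ antipode k))
        (antipode k (e i) ⊗ₜ antipode k (f i)) := by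
    intro i; rw [← mul_assoc, h.drinfeldElt_mul]; simp
  rw [Finset.sum_congr rfl fun i _ => h2 i, h.antipode_map]
  let F : H ⊗[k] H →ₗ[k] H := LinearMap.mul' k H ∘ₗ (antipode k).lTensor H
  have h3 : ∀ i, (LinearMap.mul' k H ∘ₗ (TensorProduct.comm k H H).toLinearMap ∘ₗ
        TensorProduct.map (antipode k)
        ((LinearMap.mulRight k (drinfeldElt k e f)) ∘ₗ antipode k)) (e i ⊗ₜ f i) =
      ∑ j, antipode k (f j * f i) * F (e j ⊗ₜ e i) := by
    intro i; simp [F, drinfeldElt, Finset.mul_sum, Finset.sum_mul, antipode_mul_antidistrib,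
      mul_assoc]
  simp only [h3]
  rw [Finset.sum_comm, ← h.comul_left_map]
  have h4 : ∀ i, F (comul (R := k) (e i)) = counit (R := k) (e i) • 1 := by
    intro i
    rw [← sum_mul_antipode_eq_smul (ℛ k (e i)), ← (ℛ k (e i)).eq]
    simp [F]
  simp only [h4, mul_smul_comm, mul_one]
  rw [h.counit_map, antipode_one]

/-- Commuting u past its right inverse makes S² of that element a left inverse of u; the two
one-sided inverses agree. -/
lemma drinfeldInv_mul : drinfeldInv k e f * drinfeldElt k e f = 1 := by
  have h1 : antipode k (antipode k (drinfeldInv k e f)) * drinfeldElt k e f = 1 := by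
    rw [← h.drinfeldElt_mul, h.drinfeldElt_mul_inv]
  rwa [left_inv_eq_right_inv h1 h.drinfeldElt_mul_inv] at h1

/-- `R⁻¹ = ∑ S(e_i) ⊗ f_i`. -/
lemma inv_mul : (∑ i, antipode k (e i) ⊗ₜ[k] f i) * ∑ i, e i ⊗ₜ[k] f i = 1 := by
  let F : H ⊗[k] H →ₗ[k] H ⊗[k] H :=
    (TensorProduct.mk k H H).flip 1 ∘ₗ LinearMap.mul' k H ∘ₗ (antipode k).rTensor H
  let g : H →ₗ[k] H ⊗[k] H := TensorProduct.mk k H H 1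
  have hc := h.comul_left_map g F
  have h4 : ∀ i, F (comul (R := k) (e i)) = counit (R := k) (e i) • 1 := by
    intro i
    have := congrArg ((TensorProduct.mk k H H).flip 1) (sum_antipode_mul_eq_smul (R := k) (ℛ k (e i)))
    rw [← (ℛ k (e i)).eq]
    simpa [F, Algebra.TensorProduct.one_def, TensorProduct.smul_tmul'] using this
  simp only [h4, mul_smul_comm, mul_one, h.counit_map] at hc
  rw [Finset.sum_mul_sum]
  simpa [F, g, Algebra.TensorProduct.one_def] using hc.symm

lemma mul_inv : (∑ i, e i ⊗ₜ[k] f i) * (∑ i, antipode k (e i) ⊗ₜ[k] f i) = 1 := by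
  let F : H ⊗[k] H →ₗ[k] H ⊗[k] H :=
    (TensorProduct.mk k H H).flip 1 ∘ₗ LinearMap.mul' k H ∘ₗ (antipode k).lTensor H
  let g : H →ₗ[k] H ⊗[k] H := TensorProduct.mk k H H 1
  have hc := h.comul_left_map g F
  have h4 : ∀ i, F (comul (R := k) (e i)) = counit (R := k) (e i) • 1 := by
    intro i
    have := congrArg ((TensorProduct.mk k H H).flip 1) (sum_mul_antipode_eq_smul (R := k) (ℛ k (e i)))
    rw [← (ℛ k (e i)).eq]
    simpa [F, Algebra.TensorProduct.one_def, TensorProduct.smul_tmul'] using this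
  simp only [h4, mul_smul_comm, mul_one, h.counit_map] at hc
  rw [Finset.sum_mul_sum]
  simpa [F, g, Algebra.TensorProduct.one_def] using hc.symm

end IsUniversalR
end Universal

/-! ### The monodromy element and the coproduct of u -/

section Universal
variable {k H : Type*} [Field k] [Ring H] [HopfAlgebra k H] {ι : Type*} [Fintype ι]

variable (k) in
/-- The element `R₂₁ R = ∑ f_j e_i ⊗ e_j f_i`. -/
def monodromy (e f : ι → H) : H ⊗[k] H :=
  (∑ i, f i ⊗ₜ[k] e i) * ∑ i, e i ⊗ₜ[k] f i

lemma monodromy_eq (e f : ι → H) :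
    monodromy k e f = ∑ j, ∑ i, (f j * e i) ⊗ₜ[k] (e j * f i) := by
  simp [monodromy, Finset.sum_mul_sum]

namespace IsUniversalR
variable {e f : ι → H} (h : IsUniversalR k e f)
include h

lemma flip_inv_mul : (∑ i, f i ⊗ₜ[k] antipode k (e i)) * ∑ i, f i ⊗ₜ[k] e i = 1 := by
  simpa using congrArg (Algebra.TensorProduct.comm k H H) h.inv_mul

lemma flip_mul_inv : (∑ i, f i ⊗ₜ[k] e i) * (∑ i, f i ⊗ₜ[k] antipode k (e i)) = 1 := by
  simpa using congrArg (Algebra.TensorProduct.comm k H H) h.mul_inv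

/-- The element R₂₁⁻¹ exchanges Δ and its opposite just as R does. This lets it pass the coproducts
in the computation of Δ(u). -/
lemma flip_inv_mul_comul (y : H) : (∑ i, f i ⊗ₜ[k] antipode k (e i)) * comul y =
    TensorProduct.comm k H H (comul y) * ∑ i, f i ⊗ₜ[k] antipode k (e i) := by
  have h1 : (∑ i, f i ⊗ₜ[k] e i) * TensorProduct.comm k H H (comul y) =
      comul y * ∑ i, f i ⊗ₜ[k] e i := by
    have := congrArg (Algebra.TensorProduct.comm k H H) (h.mul_comul y)
    rw [map_mul, map_mul, map_sum] at this
    simp only [Algebra.TensorProduct.comm_tmul] at this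
    rw [← (ℛ k y).eq] at this ⊢
    simpa using this
  calc _ = (∑ i, f i ⊗ₜ[k] antipode k (e i)) *
        (comul y * ∑ i, f i ⊗ₜ[k] e i) * ∑ i, f i ⊗ₜ[k] antipode k (e i) := by
        rw [mul_assoc, mul_assoc, h.flip_mul_inv, mul_one]
    _ = _ := by rw [← h1, ← mul_assoc, h.flip_inv_mul, one_mul]

/-- Expanding Δ(f_i) splits Δ(u) into two nested sums. The inner one is (u ⊗ 1)R₂₁⁻¹; carrying R₂₁⁻¹
to the right turns the outer coproduct into its opposite, and the outer sum becomes (1 ⊗ u)R⁻¹.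
Hence Δ(u) = (u ⊗ u)R⁻¹R₂₁⁻¹. -/
lemma comul_drinfeldElt_mul : comul (R := k) (drinfeldElt k e f) * monodromy k e f =
    drinfeldElt k e f ⊗ₜ drinfeldElt k e f := by
  set u := drinfeldElt k e f with hu
  set N : H ⊗[k] H := ∑ i, f i ⊗ₜ[k] antipode k (e i) with hN
  have a1 : ∑ i, (antipode k (f i) ⊗ₜ[k] (1 : H)) * comul (R := k) (e i) = u ⊗ₜ[k] 1 * N := by
    have := h.comul_left_map ((TensorProduct.mk k H H).flip 1 ∘ₗ antipode k) LinearMap.id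
    simp only [LinearMap.comp_apply, LinearMap.flip_apply, TensorProduct.mk_apply,
      LinearMap.id_apply] at this
    rw [this, Finset.sum_comm]
    have hq : ∀ q, ∑ p, (antipode k (f p * f q) ⊗ₜ[k] (1 : H)) * (e p ⊗ₜ[k] e q) =
        (LinearMap.mulRight k u).rTensor H (antipode k (f q) ⊗ₜ[k] e q) := by
      intro q
      simp [hu, drinfeldElt, Finset.mul_sum, TensorProduct.sum_tmul, antipode_mul_antidistrib,
        mul_assoc]
    -- Invariance of R under S ⊗ S raises S(f_q)u ⊗ e_q to S²(f_q)u ⊗ S(e_q), which equals uf_q ⊗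
    -- S(e_q).
    have hs := h.antipode_map ((LinearMap.mulRight k u ∘ₗ antipode k).rTensor H ∘ₗ
      (TensorProduct.comm k H H).toLinearMap)
    simp only [hq]
    simp only [LinearMap.comp_apply, LinearEquiv.coe_coe, TensorProduct.comm_tmul,
      LinearMap.rTensor_tmul, LinearMap.mulRight_apply] at hs ⊢
    rw [← hs, hN, Finset.mul_sum]
    simp [hu, h.drinfeldElt_mul]
  have a2 : ∑ i, ((1 : H) ⊗ₜ[k] antipode k (f i)) * TensorProduct.comm k H H (comul (R := k) (e i)) =
      (1 : H) ⊗ₜ[k] u * ∑ i, antipode k (e i) ⊗ₜ[k] f i := by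
    have := h.comul_left_map (TensorProduct.mk k H H 1 ∘ₗ antipode k)
      (TensorProduct.comm k H H).toLinearMap
    simp only [LinearMap.comp_apply, TensorProduct.mk_apply, LinearEquiv.coe_coe] at this
    rw [this, Finset.sum_comm]
    have hq : ∀ q, ∑ p, ((1 : H) ⊗ₜ[k] antipode k (f p * f q)) *
        TensorProduct.comm k H H (e p ⊗ₜ[k] e q) =
        (LinearMap.mulRight k u).lTensor H (e q ⊗ₜ[k] antipode k (f q)) := by
      intro q
      simp [hu, drinfeldElt, Finset.mul_sum, TensorProduct.tmul_sum, antipode_mul_antidistrib,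
        mul_assoc]
    have hs := h.antipode_map ((LinearMap.mulRight k u ∘ₗ antipode k).lTensor H)
    simp only [hq]
    simp only [LinearMap.comp_apply,
      LinearMap.lTensor_tmul, LinearMap.mulRight_apply] at hs ⊢
    rw [← hs, Finset.mul_sum]
    simp [hu, h.drinfeldElt_mul]
  have a3 : comul (R := k) u =
      ∑ p, ∑ q, ((1 : H) ⊗ₜ[k] antipode k (f p)) * ((antipode k (f q) ⊗ₜ[k] (1 : H)) *
        comul (R := k) (e q)) * comul (R := k) (e p) := by
    have := h.comul_right_map (TensorProduct.map (antipode k) (antipode k) ∘ₗ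
      (TensorProduct.comm k H H).toLinearMap) (comul (R := k))
    simp only [LinearMap.comp_apply, LinearEquiv.coe_coe, ← comul_antipode,
      ← Bialgebra.comul_mul, ← map_sum] at this
    rw [hu, drinfeldElt, this]
    simp only [TensorProduct.comm_tmul, TensorProduct.map_tmul, Bialgebra.comul_mul,
      ← mul_assoc, Algebra.TensorProduct.tmul_mul_tmul, one_mul, mul_one]
  have a4 : comul (R := k) u = (u ⊗ₜ u) * (∑ i, antipode k (e i) ⊗ₜ[k] f i) * N := by
    rw [a3]
    simp only [← Finset.sum_mul, ← Finset.mul_sum, a1]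
    have a5 : ∀ p, (1 : H) ⊗ₜ[k] antipode k (f p) * (u ⊗ₜ[k] 1 * N) * comul (R := k) (e p) =
        u ⊗ₜ[k] 1 * ((1 : H) ⊗ₜ[k] antipode k (f p) *
          TensorProduct.comm k H H (comul (R := k) (e p))) * N := by
      intro p
      rw [mul_assoc, mul_assoc, hN, h.flip_inv_mul_comul, ← hN]
      simp only [← mul_assoc, Algebra.TensorProduct.tmul_mul_tmul, one_mul, mul_one]
    simp only [a5, ← Finset.sum_mul, ← Finset.mul_sum, a2]
    simp only [← mul_assoc, Algebra.TensorProduct.tmul_mul_tmul, one_mul, mul_one]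
  rw [a4, monodromy, mul_assoc, ← mul_assoc N, h.flip_inv_mul, one_mul, mul_assoc, h.inv_mul,
    mul_one]

end IsUniversalR
end Universal

/-! ### Balancings and ribbon elements -/

section Universal
variable {k H : Type*} [Field k] [Ring H] [HopfAlgebra k H] {ι : Type*} [Fintype ι]

variable (k) in
/-- A group-like element `κ` with `κ² = u û` which implements the square of the antipode. -/
structure IsBalancingElt (e f : ι → H) (κ : H) : Prop where
  isGroupLikeElem : IsGroupLikeElem k κ
  sq_eq : κ ^ 2 = drinfeldElt k e f * ∑ i, antipode k (antipode k (e i)) * f i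
  antipode_sq : ∀ y : H, antipode k (antipode k y) = κ * y * antipode k κ

variable (k) in
/-- The ribbon element `u κ⁻¹`. -/
def ribbonElt (e f : ι → H) (κ : H) : H := drinfeldElt k e f * antipode k κ

variable (k) in
/-- The inverse `κ u⁻¹` of the ribbon element. -/
def ribbonInv (e f : ι → H) (κ : H) : H := κ * drinfeldInv k e f

/-- By (S ⊗ S)R = R the element û is S(u⁻¹), so κ² = uû amounts to κ²S(u) = u. -/
lemma IsUniversalR.hat_mul_antipode {e f : ι → H} (h : IsUniversalR k e f) :
    (∑ i, antipode k (antipode k (e i)) * f i) * antipode k (drinfeldElt k e f) = 1 := by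
  have h1 := h.antipode_map (LinearMap.mul' k H ∘ₗ (antipode k ∘ₗ antipode k).rTensor H)
  simp only [LinearMap.comp_apply, LinearMap.rTensor_tmul, LinearMap.mul'_apply] at h1
  have h2 : ∑ i, antipode k (antipode k (e i)) * f i = antipode k (drinfeldInv k e f) := by
    rw [← h1, drinfeldInv, map_sum]
    simp [antipode_mul_antidistrib]
  rw [h2, ← antipode_mul_antidistrib, h.drinfeldElt_mul_inv, antipode_one]

namespace IsBalancingElt
variable {e f : ι → H} {κ : H} (hκ : IsBalancingElt k e f κ)

section
include hκ

/-- S² is conjugation by κ, so injectivity of S comes with the balancing. -/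
lemma antipode_injective : Function.Injective (antipode k : H →ₗ[k] H) := by
  intro x y hxy
  have h1 := hκ.isGroupLikeElem.antipode_mul_cancel
  have h := congrArg (antipode k) hxy
  rw [hκ.antipode_sq, hκ.antipode_sq] at h
  have h' := congrArg (fun z => antipode k κ * z * κ) h
  simpa only [mul_assoc, h1, mul_one, ← mul_assoc (antipode k κ) κ, one_mul] using h'

end

variable (h : IsUniversalR k e f)
include hκ h

lemma sq_mul_antipode : κ ^ 2 * antipode k (drinfeldElt k e f) = drinfeldElt k e f := by
  rw [hκ.sq_eq, mul_assoc, h.hat_mul_antipode, mul_one]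

lemma ribbonElt_eq : ribbonElt k e f κ = antipode k κ * drinfeldElt k e f := by
  rw [ribbonElt, h.drinfeldElt_mul, hκ.isGroupLikeElem.antipode.antipode_antipode]

lemma ribbonElt_mul_ribbonInv : ribbonElt k e f κ * ribbonInv k e f κ = 1 := by
  rw [ribbonElt, ribbonInv, mul_assoc, ← mul_assoc (antipode k κ),
    hκ.isGroupLikeElem.antipode_mul_cancel, one_mul, h.drinfeldElt_mul_inv]

lemma ribbonInv_mul_ribbonElt : ribbonInv k e f κ * ribbonElt k e f κ = 1 := by
  rw [ribbonElt, ribbonInv, mul_assoc, ← mul_assoc (drinfeldInv k e f), h.drinfeldInv_mul, one_mul,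
    hκ.isGroupLikeElem.mul_antipode_cancel]

/-- Both u and κ implement S² by conjugation, so their quotient is central. -/
lemma ribbonElt_comm (y : H) : ribbonElt k e f κ * y = y * ribbonElt k e f κ := by
  have h1 := hκ.isGroupLikeElem.antipode_mul_cancel
  rw [hκ.ribbonElt_eq h, mul_assoc, h.drinfeldElt_mul, hκ.antipode_sq]
  simp only [← mul_assoc, h1, one_mul]

lemma ribbonInv_comm (y : H) : ribbonInv k e f κ * y = y * ribbonInv k e f κ := by
  calc _ = ribbonInv k e f κ * (y * ribbonElt k e f κ) * ribbonInv k e f κ := by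
        rw [mul_assoc, mul_assoc, hκ.ribbonElt_mul_ribbonInv h, mul_one]
    _ = _ := by rw [← hκ.ribbonElt_comm h, ← mul_assoc, hκ.ribbonInv_mul_ribbonElt h, one_mul]

/-- Here the condition on κ² enters: S(v) = κS(u), whereas v = κ⁻¹u = κ⁻¹κ²S(u). -/
lemma antipode_ribbonElt : antipode k (ribbonElt k e f κ) = ribbonElt k e f κ := by
  have h1 := hκ.isGroupLikeElem.antipode_mul_cancel
  conv_rhs => rw [hκ.ribbonElt_eq h, ← hκ.sq_mul_antipode h]
  rw [ribbonElt, antipode_mul_antidistrib, hκ.isGroupLikeElem.antipode_antipode, pow_two,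
    ← mul_assoc, ← mul_assoc, h1, one_mul]

lemma antipode_ribbonInv : antipode k (ribbonInv k e f κ) = ribbonInv k e f κ := by
  have h1 : ribbonElt k e f κ * antipode k (ribbonInv k e f κ) = 1 := by
    conv_lhs => rw [← hκ.antipode_ribbonElt h]
    rw [← antipode_mul_antidistrib, hκ.ribbonInv_mul_ribbonElt h, antipode_one]
  exact (left_inv_eq_right_inv (hκ.ribbonInv_mul_ribbonElt h) h1).symm

/-- Since κ is group-like, the formula for Δ(u) passes to v as Δ(v)M = v ⊗ v. Writing M through
Δ(v⁻¹) allows the invariance of an integral to act on it. -/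
lemma monodromy_eq_mul_comul : monodromy k e f =
    ribbonElt k e f κ ⊗ₜ ribbonElt k e f κ * comul (R := k) (ribbonInv k e f κ) := by
  have hv : comul (R := k) (ribbonElt k e f κ) * monodromy k e f =
      ribbonElt k e f κ ⊗ₜ ribbonElt k e f κ := by
    rw [hκ.ribbonElt_eq h, Bialgebra.comul_mul, mul_assoc, h.comul_drinfeldElt_mul,
      hκ.isGroupLikeElem.antipode.comul_eq_tmul_self, Algebra.TensorProduct.tmul_mul_tmul]
  have hc : ∀ t : H ⊗[k] H, ribbonElt k e f κ ⊗ₜ ribbonElt k e f κ * t =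
      t * ribbonElt k e f κ ⊗ₜ ribbonElt k e f κ := by
    intro t
    induction t with
    | zero => simp
    | add x y hx hy => rw [mul_add, add_mul, hx, hy]
    | tmul x y =>
      simp only [Algebra.TensorProduct.tmul_mul_tmul, hκ.ribbonElt_comm h]
  rw [hc, ← hv, ← mul_assoc, ← Bialgebra.comul_mul, hκ.ribbonInv_mul_ribbonElt h,
    Bialgebra.comul_one, one_mul]

end IsBalancingElt

/-! ### The operator attached to an integral and its relation up to a scalar -/

variable (k) in
/-- The operator `X ↦ ∑ λ(X f_j e_i) S(f_i) S(e_j)`. -/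
def transformS (e f : ι → H) (lam : H →ₗ[k] k) : H →ₗ[k] H :=
  ∑ i, ∑ j, (lam ∘ₗ LinearMap.mulRight k (f j * e i)).smulRight
    (antipode k (f i) * antipode k (e j))

lemma transformS_apply (e f : ι → H) (lam : H →ₗ[k] k) (X : H) : transformS k e f lam X =
    antipode k (contractLeft (lam ∘ₗ LinearMap.mulLeft k X) (monodromy k e f)) := by
  rw [monodromy_eq, Finset.sum_comm]
  simp [transformS, antipode_mul_antidistrib, mul_assoc]

/-- This is (id ⊗ Δ)M = R₂₁M₁₃R₁₂ with λ applied to the first leg and g to the third. -/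
lemma IsUniversalR.contract_comul {e f : ι → H} (h : IsUniversalR k e f) (lam g : H →ₗ[k] k) :
    contractRight g (comul (contractLeft lam (monodromy k e f))) =
      ∑ p, ∑ r, lam (f p * contractRight g (monodromy k e f) * e r) • (e p * f r) := by
  have h1 : ∀ i, ∑ j, algebraMap k (H ⊗[k] H) (lam (f j * e i)) *
      (comul (R := k) (e j) * comul (R := k) (f i)) =
      ∑ p, ∑ q, algebraMap k (H ⊗[k] H) (lam (f p * f q * e i)) *
      ((e p ⊗ₜ e q) * comul (R := k) (f i)) := by
    intro i
    exact h.comul_left_map (Algebra.linearMap k (H ⊗[k] H) ∘ₗ lam ∘ₗ LinearMap.mulRight k (e i))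
      (LinearMap.mulRight k (comul (R := k) (f i)))
  have h2 : ∀ p q, ∑ i, ((e p ⊗ₜ e q) * comul (R := k) (f i)) *
      algebraMap k (H ⊗[k] H) (lam (f p * f q * e i)) =
      ∑ r, ∑ s, ((e p ⊗ₜ e q) * (f r ⊗ₜ[k] f s)) *
      algebraMap k (H ⊗[k] H) (lam (f p * f q * (e s * e r))) := by
    intro p q
    exact h.comul_right_map (LinearMap.mulLeft k (e p ⊗ₜ e q))
      (Algebra.linearMap k (H ⊗[k] H) ∘ₗ lam ∘ₗ LinearMap.mulLeft k (f p * f q))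
  have h3 : comul (R := k) (contractLeft lam (monodromy k e f)) =
      ∑ p, ∑ q, ∑ r, ∑ s, lam (f p * f q * (e s * e r)) •
        ((e p * f r) ⊗ₜ[k] (e q * f s)) := by
    rw [monodromy_eq, Finset.sum_comm]
    simp only [map_sum, contractLeft_tmul, map_smul, Bialgebra.comul_mul]
    simp only [← Algebra.smul_def] at h1
    simp only [h1]
    rw [Finset.sum_comm]
    refine Finset.sum_congr rfl fun p _ => ?_
    rw [Finset.sum_comm]
    refine Finset.sum_congr rfl fun q _ => ?_
    simp only [← Algebra.commutes, ← Algebra.smul_def, Algebra.TensorProduct.tmul_mul_tmul] at h2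
    exact h2 p q
  rw [h3, monodromy_eq]
  simp only [map_sum, map_smul, contractRight_tmul, Finset.mul_sum, Finset.sum_mul,
    Finset.sum_smul]
  refine Finset.sum_congr rfl fun p _ => ?_
  rw [Finset.sum_comm]
  refine Finset.sum_congr rfl fun r _ => Finset.sum_congr rfl fun q _ =>
    Finset.sum_congr rfl fun s _ => ?_
  simp [smul_smul, mul_assoc, mul_comm]

/-- Both occurrences of M that get contracted against the integral are replaced by (v ⊗ v)Δ(v⁻¹).
Centrality and S(v) = v cancel the stray factors v against v⁻¹, leaving pure coproducts on which λ
is invariant. -/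
lemma IsBalancingElt.transformS_relation {e f : ι → H} {κ : H} (hκ : IsBalancingElt k e f κ)
    (h : IsUniversalR k e f) {lam : H →ₗ[k] k} (hl : IsRightIntegral lam) (X : H) :
    transformS k e f lam (ribbonInv k e f κ * transformS k e f lam X) =
      lam (ribbonInv k e f κ) •
        (ribbonElt k e f κ * transformS k e f lam (ribbonElt k e f κ * X)) := by
  set v := ribbonElt k e f κ with hv
  set w := ribbonInv k e f κ with hw
  have hvw : v * w = 1 := hκ.ribbonElt_mul_ribbonInv h
  have hvc : ∀ y, v * y = y * v := hκ.ribbonElt_comm h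
  have hwc : ∀ y, w * y = y * w := hκ.ribbonInv_comm h
  have hSv : antipode k v = v := hκ.antipode_ribbonElt h
  have hSw : antipode k w = w := hκ.antipode_ribbonInv h
  have hM : monodromy k e f = v ⊗ₜ v * comul w := hκ.monodromy_eq_mul_comul h
  set m := contractLeft (lam ∘ₗ LinearMap.mulLeft k X) (monodromy k e f) with hm
  -- The form y ↦ λ(S(y)v⁻¹) is the one that `IsRightIntegral.shift` produces from Δ(v⁻¹).
  set g : H →ₗ[k] k := lam ∘ₗ LinearMap.mulRight k w ∘ₗ antipode k with hg
  have e1 : w * transformS k e f lam X = antipode k (w * m) := by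
    rw [transformS_apply, antipode_mul_antidistrib, hSw, hwc]
  have e2 : contractLeft (lam ∘ₗ LinearMap.mulLeft k (antipode k (w * m))) (monodromy k e f) =
      v * contractRight g (comul m) := by
    rw [hM, contractLeft_mul]
    congr 1
    rw [← hl.shift]
    congr 2
    ext y
    simp only [LinearMap.comp_apply, LinearMap.mulLeft_apply, antipode_mul_antidistrib, hSw]
    rw [mul_assoc, ← mul_assoc w, hκ.ribbonInv_mul_ribbonElt h, one_mul]
  -- The factor v in the second leg of M cancels the v⁻¹ in g, so only λ ∘ S acts on Δ(v⁻¹). This is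
  -- the source of the scalar λ(v⁻¹).
  have e3 : contractRight g (monodromy k e f) = lam w • v := by
    have : g ∘ₗ LinearMap.mulLeft k v = lam ∘ₗ antipode k := by
      ext y
      simp only [hg, LinearMap.comp_apply, LinearMap.mulLeft_apply, LinearMap.mulRight_apply,
        antipode_mul_antidistrib, hSv]
      rw [mul_assoc, hvw, mul_one]
    rw [hM, contractRight_mul, this, hl.comp_antipode hκ.antipode_injective, hSw, mul_smul_comm,
      mul_one]
  have e4 : contractRight g (comul m) =
      lam w • contractLeft (lam ∘ₗ LinearMap.mulLeft k (v * X)) (monodromy k e f) := by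
    rw [hm, h.contract_comul, e3, monodromy_eq, map_sum, Finset.smul_sum]
    refine Finset.sum_congr rfl fun p _ => ?_
    rw [map_sum, Finset.smul_sum]
    refine Finset.sum_congr rfl fun r _ => ?_
    have : X * (f p * v * e r) = v * X * (f p * e r) := by
      rw [← hvc (f p), hvc X]; simp only [mul_assoc]
    simp only [LinearMap.comp_apply, LinearMap.mulLeft_apply, contractLeft_tmul, smul_smul,
      mul_smul_comm, smul_mul_assoc, map_smul, smul_eq_mul, this]
  rw [e1, transformS_apply, e2, e4, transformS_apply, mul_smul_comm, map_smul,
    antipode_mul_antidistrib, hSv, ← hvc (antipode k _)]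

end Universal

/-! ### Dual bases and the canonical element of A ⊗ A° -/

section Dual
variable {k A : Type*} [Field k] [Ring A] [HopfAlgebra k A] {ι : Type*} [Fintype ι]
  (e : Module.Basis ι k A)

/-- The dual basis of `A°`. -/
def dualVec (i : ι) : CoopDual k A := (toDual k A).symm (e.coord i)

omit [Fintype ι] in
lemma dualVec_apply (i : ι) (y : A) : dualVec e i y = e.repr y i := rfl

lemma sum_dualVec_smul (y : A) : ∑ i, dualVec e i y • e i = y := e.sum_repr y

lemma sum_smul_dualVec (l : CoopDual k A) : ∑ i, l (e i) • dualVec e i = l := by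
  refine coopDual_ext fun y => ?_
  rw [coop_sum_apply]
  conv_rhs => rw [← e.sum_repr y]
  rw [map_sum]
  refine Finset.sum_congr rfl fun i _ => ?_
  rw [map_smul, map_smul, LinearMap.smul_apply, dualVec_apply, smul_eq_mul, smul_eq_mul, mul_comm]

lemma comul_eq_sum_dualVec (y : A) : comul (R := k) y =
    ∑ p, ∑ q, (dualVec e p * dualVec e q) y • (e p ⊗ₜ[k] e q) := by
  rw [← (ℛ k y).eq]
  simp only [conv_apply, Finset.sum_smul]
  have : ∀ i, (ℛ k y).left i ⊗ₜ[k] (ℛ k y).right i = ∑ p, ∑ q,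
      (dualVec e p ((ℛ k y).left i) * dualVec e q ((ℛ k y).right i)) • (e p ⊗ₜ[k] e q) := by
    intro i
    conv_lhs => rw [← sum_dualVec_smul e ((ℛ k y).left i), ← sum_dualVec_smul e ((ℛ k y).right i)]
    simp only [TensorProduct.sum_tmul, TensorProduct.tmul_sum, TensorProduct.smul_tmul_smul]
    rw [Finset.sum_comm]
  simp only [this]
  rw [Finset.sum_comm]
  refine Finset.sum_congr rfl fun p _ => ?_
  rw [Finset.sum_comm]

/-- The product of A° is dual to Δ, so the structure constants agree; this becomes one hexagon
identity in the double. -/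
lemma sum_comul_tmul_dualVec : ∑ i, comul (R := k) (e i) ⊗ₜ[k] dualVec e i =
    ∑ p, ∑ q, (e p ⊗ₜ[k] e q) ⊗ₜ[k] (dualVec e p * dualVec e q) := by
  have h : ∀ p q, (e p ⊗ₜ[k] e q) ⊗ₜ[k] (dualVec e p * dualVec e q) =
      ∑ i, ((dualVec e p * dualVec e q) (e i) • (e p ⊗ₜ[k] e q)) ⊗ₜ[k] dualVec e i := by
    intro p q
    conv_lhs => rw [← sum_smul_dualVec e (dualVec e p * dualVec e q)]
    simp only [TensorProduct.tmul_sum, TensorProduct.smul_tmul]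
  simp only [h]
  simp only [comul_eq_sum_dualVec e, TensorProduct.sum_tmul]
  rw [Finset.sum_comm]
  refine Finset.sum_congr rfl fun p _ => ?_
  rw [Finset.sum_comm]

variable [FiniteDimensional k A]

lemma comul_coop_eq_sum_dualVec (l : CoopDual k A) : comul (R := k) l =
    ∑ p, ∑ q, l (e q * e p) • (dualVec e p ⊗ₜ[k] dualVec e q) := by
  refine coop_tensor_ext fun a b => ?_
  rw [coop_comul_eq, pairAt_coopComul]
  conv_lhs => rw [← sum_dualVec_smul e a, ← sum_dualVec_smul e b]
  simp only [map_sum, map_smul, pairAt_tmul, Finset.sum_mul_sum]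
  rw [Finset.sum_comm]
  refine Finset.sum_congr rfl fun p _ => Finset.sum_congr rfl fun q _ => ?_
  rw [smul_mul_smul_comm, map_smul, smul_eq_mul, smul_eq_mul]
  ring

/-- The other hexagon identity. The factors e_q and e_p appear reversed because A° carries the
opposite comultiplication. -/
lemma sum_comul_dualVec_tmul : ∑ i, comul (R := k) (dualVec e i) ⊗ₜ[k] e i =
    ∑ p, ∑ q, (dualVec e p ⊗ₜ[k] dualVec e q) ⊗ₜ[k] (e q * e p) := by
  have h : ∀ p q, (dualVec e p ⊗ₜ[k] dualVec e q) ⊗ₜ[k] (e q * e p) =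
      ∑ i, (dualVec e i (e q * e p) • (dualVec e p ⊗ₜ[k] dualVec e q)) ⊗ₜ[k] e i := by
    intro p q
    conv_lhs => rw [← sum_dualVec_smul e (e q * e p)]
    simp only [TensorProduct.tmul_sum, TensorProduct.smul_tmul]
  simp only [h]
  simp only [comul_coop_eq_sum_dualVec e, TensorProduct.sum_tmul]
  rw [Finset.sum_comm]
  refine Finset.sum_congr rfl fun p _ => ?_
  rw [Finset.sum_comm]

lemma sum_right_smul_left (l : CoopDual k A) (b : A) :
    ∑ r ∈ (ℛ k l).index, (ℛ k l).right r b • (ℛ k l).left r = actR b l := by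
  refine coopDual_ext fun y => ?_
  rw [actR_apply, ← pairAt_coopComul, ← coop_comul_eq, ← (ℛ k l).eq, coop_sum_apply, map_sum]
  refine Finset.sum_congr rfl fun r _ => ?_
  rw [pairAt_tmul, map_smul, LinearMap.smul_apply, smul_eq_mul, mul_comm]

lemma sum_left_smul_right (l : CoopDual k A) (b : A) :
    ∑ r ∈ (ℛ k l).index, (ℛ k l).left r b • (ℛ k l).right r = actL b l := by
  refine coopDual_ext fun y => ?_
  rw [actL_apply, ← pairAt_coopComul, ← coop_comul_eq, ← (ℛ k l).eq, coop_sum_apply, map_sum]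
  refine Finset.sum_congr rfl fun r _ => ?_
  rw [pairAt_tmul, map_smul, LinearMap.smul_apply, smul_eq_mul]

variable [HasBijectiveAntipode k A]

lemma coop_antipode_apply (l : CoopDual k A) (y : A) :
    (antipode k l : CoopDual k A) y = l (antipodeInv k A y) := rfl

/-- The antipode of A° is the transpose of S⁻¹, which undoes S across the canonical pairing. -/
lemma sum_antipode_tmul_dualVec : ∑ i, antipode k (e i) ⊗ₜ[k] antipode k (dualVec e i) =
    ∑ i, e i ⊗ₜ[k] dualVec e i := by
  have h : ∀ i, antipode k (e i) ⊗ₜ[k] antipode k (dualVec e i) = ∑ j, e j ⊗ₜ[k]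
      (dualVec e j (antipode k (e i)) • antipode k (dualVec e i)) := by
    intro i
    conv_lhs => rw [← sum_dualVec_smul e (antipode k (e i))]
    simp only [TensorProduct.sum_tmul, TensorProduct.smul_tmul]
  simp only [h]
  rw [Finset.sum_comm]
  refine Finset.sum_congr rfl fun j _ => ?_
  rw [← TensorProduct.tmul_sum]
  congr 1
  simp only [← map_smul, ← map_sum]
  let m : CoopDual k A := (toDual k A).symm (toDual k A (dualVec e j) ∘ₗ antipode k)
  have hm : ∀ y, m y = dualVec e j (antipode k y) := fun _ => rfl
  simp only [← hm]
  rw [sum_smul_dualVec]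
  refine coopDual_ext fun y => ?_
  rw [coop_antipode_apply, hm, antipode_antipodeInv]

end Dual

/-! ### The canonical element is an R-matrix of the double -/

namespace DrinfeldDouble
variable {k A : Type*} [Field k] [Ring A] [HopfAlgebra k A] [HasBijectiveAntipode k A]
  [FiniteDimensional k A] {ι : Type*} [Fintype ι] (e : Module.Basis ι k A)

lemma antipode_ofAlg (y : A) : antipode k (ofAlg k A y) = ofAlg k A (antipode k y) := by
  have := antipodeMap_apply (1 : CoopDual k A) y
  rwa [map_one, one_mul, antipode_one, map_one, mul_one] at this

lemma antipode_ofDual (l : CoopDual k A) :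
    antipode k (ofDual k A l) = ofDual k A (antipode k l) := by
  have := antipodeMap_apply l (1 : A)
  rwa [map_one, mul_one, antipode_one, map_one, one_mul] at this

omit [FiniteDimensional k A] in
lemma matched_apply (l : CoopDual k A) (y : A) :
    ∑ i ∈ (ℛ k y).index, ofAlg k A ((ℛ k y).left i) * ofDual k A (actR ((ℛ k y).right i) l) =
    ∑ i ∈ (ℛ k y).index, ofDual k A (actL ((ℛ k y).left i) l) * ofAlg k A ((ℛ k y).right i) := by
  have := conv_apply_ext (matched_ofDual_ofAlg (k := k) (A := A) l) y
  simp only [conv_mul_apply] at this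
  exact this

/-- Multiplication by A in the first leg is transposed to the translation actions on f_j in the
second. The coefficient of e_j is then the commutation relation of the double at (f_j, y). -/
lemma canonical_mul_comul_ofAlg (y : A) :
    (∑ i, basisElt e i ⊗ₜ[k] dualElt e i) * comul (ofAlg k A y) =
      TensorProduct.comm k _ _ (comul (ofAlg k A y)) * ∑ i, basisElt e i ⊗ₜ[k] dualElt e i := by
  have hd : ∀ i, dualElt e i = ofDual k A (dualVec e i) := fun _ => rfl
  have h1 : ∀ b c : A, ∑ i, (basisElt e i * ofAlg k A b) ⊗ₜ[k] (dualElt e i * ofAlg k A c) =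
      ∑ j, basisElt e j ⊗ₜ[k] (ofDual k A (actL b (dualVec e j)) * ofAlg k A c) := by
    intro b c
    have : ∀ i, (basisElt e i * ofAlg k A b) ⊗ₜ[k] (dualElt e i * ofAlg k A c) =
        ∑ j, basisElt e j ⊗ₜ[k]
          (ofDual k A (dualVec e j (e i * b) • dualVec e i) * ofAlg k A c) := by
      intro i
      rw [basisElt, ← map_mul, ← sum_dualVec_smul e (e i * b), map_sum, TensorProduct.sum_tmul]
      refine Finset.sum_congr rfl fun j _ => ?_
      rw [map_smul, map_smul, TensorProduct.smul_tmul, hd, smul_mul_assoc, sum_dualVec_smul]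
      rfl
    simp only [this]
    rw [Finset.sum_comm]
    simp only [← TensorProduct.tmul_sum, ← Finset.sum_mul, ← map_sum, ← actL_apply,
      sum_smul_dualVec]
  have h2 : ∀ b c : A, ∑ i, (ofAlg k A b * basisElt e i) ⊗ₜ[k] (ofAlg k A c * dualElt e i) =
      ∑ j, basisElt e j ⊗ₜ[k] (ofAlg k A c * ofDual k A (actR b (dualVec e j))) := by
    intro b c
    have : ∀ i, (ofAlg k A b * basisElt e i) ⊗ₜ[k] (ofAlg k A c * dualElt e i) =
        ∑ j, basisElt e j ⊗ₜ[k]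
          (ofAlg k A c * ofDual k A (dualVec e j (b * e i) • dualVec e i)) := by
      intro i
      rw [basisElt, ← map_mul, ← sum_dualVec_smul e (b * e i), map_sum, TensorProduct.sum_tmul]
      refine Finset.sum_congr rfl fun j _ => ?_
      rw [map_smul, map_smul, TensorProduct.smul_tmul, hd, mul_smul_comm, sum_dualVec_smul]
      rfl
    simp only [this]
    rw [Finset.sum_comm]
    simp only [← TensorProduct.tmul_sum, ← Finset.mul_sum, ← map_sum, ← actR_apply,
      sum_smul_dualVec]
  rw [comul_ofAlg, ← (ℛ k y).eq]
  simp only [map_sum, TensorProduct.map_tmul, TensorProduct.comm_tmul, AlgHom.toLinearMap_apply]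
  rw [Finset.sum_mul_sum, Finset.sum_comm, Finset.sum_mul_sum]
  simp only [Algebra.TensorProduct.tmul_mul_tmul, h1, h2]
  rw [Finset.sum_comm]
  conv_rhs => rw [Finset.sum_comm]
  simp only [← TensorProduct.tmul_sum, matched_apply]

/-- Here products in A° are expanded in the second leg, which transposes them to coproducts of e_j
in the first. The coefficient of f_j is the commutation relation at (l, e_j). -/
lemma canonical_mul_comul_ofDual (l : CoopDual k A) :
    (∑ i, basisElt e i ⊗ₜ[k] dualElt e i) * comul (ofDual k A l) =
      TensorProduct.comm k _ _ (comul (ofDual k A l)) * ∑ i, basisElt e i ⊗ₜ[k] dualElt e i := by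
  have hd : ∀ i, dualElt e i = ofDual k A (dualVec e i) := fun _ => rfl
  have hs : ∀ m : CoopDual k A, ofDual k A m = ∑ j, m (e j) • dualElt e j := by
    intro m
    conv_lhs => rw [← sum_smul_dualVec e m]
    simp only [map_sum, map_smul, hd]
  have e0 : ∀ (c : CoopDual k A) i, dualElt e i * ofDual k A c =
      ∑ j, (dualVec e i * c) (e j) • dualElt e j := by
    intro c i
    rw [hd, ← map_mul, hs]
  have e0' : ∀ (c : CoopDual k A) i, ofDual k A c * dualElt e i =
      ∑ j, (c * dualVec e i) (e j) • dualElt e j := by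
    intro c i
    rw [hd, ← map_mul, hs]
  have h1 : ∀ b c : CoopDual k A,
      ∑ i, (basisElt e i * ofDual k A b) ⊗ₜ[k] (dualElt e i * ofDual k A c) =
      ∑ j, (∑ t ∈ (ℛ k (e j)).index, ofAlg k A ((ℛ k (e j)).left t) *
        ofDual k A (c ((ℛ k (e j)).right t) • b)) ⊗ₜ[k] dualElt e j := by
    intro b c
    simp only [e0, TensorProduct.tmul_sum]
    rw [Finset.sum_comm]
    refine Finset.sum_congr rfl fun j _ => ?_
    simp only [TensorProduct.tmul_smul, TensorProduct.smul_tmul', ← TensorProduct.sum_tmul]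
    congr 1
    simp only [conv_apply, Finset.sum_smul]
    rw [Finset.sum_comm]
    refine Finset.sum_congr rfl fun t _ => ?_
    conv_rhs => rw [← sum_dualVec_smul e ((ℛ k (e j)).left t)]
    simp only [map_sum, map_smul, Finset.sum_mul, Finset.smul_sum, basisElt, smul_mul_assoc,
      mul_smul_comm, smul_smul]
    refine Finset.sum_congr rfl fun _ _ => ?_
    rw [mul_comm]
  have h2 : ∀ b c : CoopDual k A,
      ∑ i, (ofDual k A b * basisElt e i) ⊗ₜ[k] (ofDual k A c * dualElt e i) =
      ∑ j, (∑ t ∈ (ℛ k (e j)).index, ofDual k A (c ((ℛ k (e j)).left t) • b) *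
        ofAlg k A ((ℛ k (e j)).right t)) ⊗ₜ[k] dualElt e j := by
    intro b c
    simp only [e0', TensorProduct.tmul_sum]
    rw [Finset.sum_comm]
    refine Finset.sum_congr rfl fun j _ => ?_
    simp only [TensorProduct.tmul_smul, TensorProduct.smul_tmul', ← TensorProduct.sum_tmul]
    congr 1
    simp only [conv_apply, Finset.sum_smul]
    rw [Finset.sum_comm]
    refine Finset.sum_congr rfl fun t _ => ?_
    conv_rhs => rw [← sum_dualVec_smul e ((ℛ k (e j)).right t)]
    simp only [map_sum, map_smul, Finset.mul_sum, basisElt, smul_mul_assoc, mul_smul_comm,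
      smul_smul]
    refine Finset.sum_congr rfl fun _ _ => ?_
    rw [mul_comm]
  rw [comul_ofDual, ← (ℛ k l).eq]
  simp only [map_sum, TensorProduct.map_tmul, TensorProduct.comm_tmul, AlgHom.toLinearMap_apply]
  rw [Finset.sum_mul_sum, Finset.sum_comm, Finset.sum_mul_sum]
  simp only [Algebra.TensorProduct.tmul_mul_tmul, h1, h2]
  rw [Finset.sum_comm]
  conv_rhs => rw [Finset.sum_comm]
  refine Finset.sum_congr rfl fun j _ => ?_
  rw [← TensorProduct.sum_tmul, ← TensorProduct.sum_tmul]
  congr 1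
  rw [Finset.sum_comm]
  conv_rhs => rw [Finset.sum_comm]
  simp only [← Finset.mul_sum, ← Finset.sum_mul, ← map_sum, sum_right_smul_left,
    sum_left_smul_right, matched_apply]

lemma isUniversalR : IsUniversalR k (basisElt e) (dualElt e) where
  mul_comul y := by
    induction y using induction_on with
    | hadd a b ha hb => simp only [map_add, mul_add, add_mul, ha, hb]
    | h l y =>
      have hm : ∀ s t : DrinfeldDouble k A ⊗[k] DrinfeldDouble k A,
          TensorProduct.comm k _ _ (s * t) =
            TensorProduct.comm k _ _ s * TensorProduct.comm k _ _ t :=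
        map_mul (Algebra.TensorProduct.comm k (DrinfeldDouble k A) (DrinfeldDouble k A))
      rw [Bialgebra.comul_mul, hm, ← mul_assoc, canonical_mul_comul_ofDual, mul_assoc,
        canonical_mul_comul_ofAlg, mul_assoc]
  comul_left := by
    have := congrArg (TensorProduct.map (TensorProduct.map (ofAlg k A).toLinearMap
      (ofAlg k A).toLinearMap) (ofDual k A).toLinearMap) (sum_comul_tmul_dualVec e)
    simp only [map_sum, TensorProduct.map_tmul, ← comul_ofAlg, AlgHom.toLinearMap_apply,
      map_mul] at this
    exact this
  comul_right := by
    have := congrArg (TensorProduct.map (TensorProduct.map (ofDual k A).toLinearMap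
      (ofDual k A).toLinearMap) (ofAlg k A).toLinearMap) (sum_comul_dualVec_tmul e)
    simp only [map_sum, TensorProduct.map_tmul, ← comul_ofDual, AlgHom.toLinearMap_apply,
      map_mul] at this
    exact this
  counit_left := by
    rw [← map_one (ofDual k A), ← sum_smul_dualVec e (1 : CoopDual k A), map_sum]
    refine Finset.sum_congr rfl fun i _ => ?_
    rw [map_smul, basisElt, counit_ofAlg]
    rfl
  antipode_antipode := by
    have := congrArg (TensorProduct.map (ofAlg k A).toLinearMap (ofDual k A).toLinearMap)
      (sum_antipode_tmul_dualVec e)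
    simp only [map_sum, TensorProduct.map_tmul, AlgHom.toLinearMap_apply, ← antipode_ofAlg,
      ← antipode_ofDual] at this
    exact this

end DrinfeldDouble

/-! ### Integrals and cointegrals on A -/

section Integrals
variable {k A : Type*} [Field k] [Ring A] [HopfAlgebra k A]

lemma IsLeftIntegral.contractRight_comul {μ : Module.Dual k A} (hμ : IsLeftIntegral μ) (h : A) :
    contractRight μ (comul h) = μ h • (1 : A) := hμ h

lemma IsComodulus.contractLeft_comul {μ : Module.Dual k A} {a : A} (ha : IsComodulus μ a) (h : A) :
    contractLeft μ (comul h) = μ h • a := ha h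

/-- `∑ μ(c'' h) S(c') = ∑ μ(c h'') h'` for a left integral `μ`. -/
lemma IsLeftIntegral.shift {μ : Module.Dual k A} (hμ : IsLeftIntegral μ) (c h : A) :
    antipode k (contractRight (μ ∘ₗ LinearMap.mulRight k h) (comul c)) =
      contractRight (μ ∘ₗ LinearMap.mulLeft k c) (comul h) := by
  let φ : WithConv (A →ₗ[k] A) := toConv
    { toFun := fun c => contractRight (μ ∘ₗ LinearMap.mulLeft k c) (comul h)
      map_add' := fun c d => by
        conv_lhs => rw [← (ℛ k h).eq]
        conv_rhs => rw [← (ℛ k h).eq]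
        simp [add_mul, add_smul, Finset.sum_add_distrib]
      map_smul' := fun c d => by
        conv_lhs => rw [← (ℛ k h).eq]
        conv_rhs => rw [← (ℛ k h).eq]
        simp [Finset.smul_sum, mul_smul] }
  let ψ : WithConv (A →ₗ[k] A) := toConv ((μ ∘ₗ LinearMap.mulRight k h).smulRight (1 : A))
  have hφ : ∀ c, φ c = contractRight (μ ∘ₗ LinearMap.mulLeft k c) (comul h) := fun _ => rfl
  have hψ : ∀ c, ψ c = μ (c * h) • (1 : A) := fun _ => rfl
  -- This is invariance of μ at the product ch; convolving with S on the left isolates φ.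
  have h1 : toConv (LinearMap.id : A →ₗ[k] A) * φ = ψ := by
    apply WithConv.ext; ext1 c
    change (toConv (LinearMap.id : A →ₗ[k] A) * φ) c = ψ c
    rw [hψ, ← hμ.contractRight_comul, Bialgebra.comul_mul, conv_mul_apply]
    conv_rhs => rw [← (ℛ k c).eq]
    simp only [map_sum, Finset.sum_mul, contractRight_mul, hφ]
    rfl
  have h2 : φ = toConv (antipode k (A := A)) * ψ := by
    rw [← h1, ← mul_assoc, LinearMap.antipode_mul_id, one_mul]
  rw [← hφ, h2, conv_mul_apply, ← (ℛ k c).eq]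
  simp [hψ]

/-- From hx = ε(h)x one gets Δ(h)Δ(x) = ε(h)Δ(x); cancelling the first factor of Δ(h) by the
antipode gives the claim. -/
lemma IsLeftCointegral.shift {x : A} (hx : IsLeftCointegral k x) (h : A) :
    ((1 : A) ⊗ₜ[k] h) * comul x = (antipode k h ⊗ₜ[k] (1 : A)) * comul x := by
  let i₁ : A →ₐ[k] A ⊗[k] A := Algebra.TensorProduct.includeLeft
  let i₂ : A →ₐ[k] A ⊗[k] A := Algebra.TensorProduct.includeRight
  have h1 : toConv (comul (R := k) (A := A)) * cst k A (comul (R := k) x) =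
      cst k A (comul (R := k) x) := by
    apply WithConv.ext; ext1 z
    rw [mul_cst]
    change comul (R := k) z * comul (R := k) x = counit (R := k) z • comul (R := k) x
    rw [← Bialgebra.comul_mul, hx, map_smul]
  have h2 : toConv i₂.toLinearMap * cst k A (comul (R := k) x) =
      toConv (i₁.toLinearMap ∘ₗ antipode k) * cst k A (comul (R := k) x) := by
    conv_rhs => rw [← h1, comul_eq_conv, mul_assoc, ← mul_assoc]
    rw [conv_antipode_mul, one_mul]
  have h3 := conv_apply_ext h2 h
  rwa [mul_cst, mul_cst] at h3

/-- The map `z ↦ ∑ μ(z x') x''`. -/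
def frobeniusMap (μ : Module.Dual k A) (x : A) : A →ₗ[k] A :=
  contractLeft μ ∘ₗ LinearMap.mulRight k (comul x) ∘ₗ (TensorProduct.mk k A A).flip 1

lemma frobeniusMap_eq (μ : Module.Dual k A) (x z : A) : frobeniusMap μ x z =
    contractLeft (μ ∘ₗ LinearMap.mulLeft k z) (comul x) := by
  change contractLeft μ (z ⊗ₜ 1 * comul x) = _
  rw [contractLeft_mul, one_mul]

/-- The cointegral property carries S(h) from the first leg of Δ(x) to h in the second, and what is
left is the comodulus. -/
lemma frobeniusMap_antipode {μ : Module.Dual k A} {x a : A} (hx : IsLeftCointegral k x)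
    (hμx : μ x = 1) (ha : IsComodulus μ a) (h : A) :
    frobeniusMap μ x (antipode k h) = h * a := by
  change contractLeft μ (antipode k h ⊗ₜ 1 * comul x) = _
  rw [← hx.shift, contractLeft_mul, LinearMap.mulLeft_one, LinearMap.comp_id,
    ha.contractLeft_comul, hμx, one_smul]

/-! ### Translating a cointegral by a square root of the modulus -/

section Character
variable {μ : Module.Dual k A} {x a : A} (l : A →ₐ[k] k)

/-- The translate `∑ l(x') x''` of `x` by a character. -/
def translate (x : A) : A := contractLeft l.toLinearMap (comul x)

lemma translate_mul_distrib (y z : A) : translate l (y * z) = translate l y * translate l z := by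
  have h : ∀ s t : A ⊗[k] A, contractLeft l.toLinearMap (s * t) =
      contractLeft l.toLinearMap s * contractLeft l.toLinearMap t := by
    intro s t
    induction s with
    | zero => simp
    | add a b ha hb => simp only [add_mul, map_add, ha, hb]
    | tmul b c =>
      induction t with
      | zero => simp
      | add a b ha hb => simp only [mul_add, map_add, ha, hb]
      | tmul d e => simp [smul_smul, mul_comm]
  rw [translate, Bialgebra.comul_mul, h]
  rfl

/-- Apply l to ∑ x'μ(x'') = 1. -/
lemma apply_translate (hμ : IsLeftIntegral μ) (hμx : μ x = 1) : μ (translate l x) = 1 := by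
  have := congrArg l (hμ.contractRight_comul x)
  rw [map_smul, map_one, hμx, one_smul, ← (ℛ k x).eq] at this
  rw [translate, ← (ℛ k x).eq, ← this]
  simp [mul_comm]

lemma mul_translate (hx : IsLeftCointegral k x) (z : A) :
    z * translate l x = l (antipode k z) • translate l x := by
  have h1 := congrArg (contractLeft l.toLinearMap) (hx.shift z)
  have h2 : l.toLinearMap ∘ₗ LinearMap.mulLeft k (antipode k z) =
      l (antipode k z) • l.toLinearMap := by ext; simp
  rw [contractLeft_mul, contractLeft_mul, LinearMap.mulLeft_one, LinearMap.comp_id, one_mul,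
    h2] at h1
  rw [translate, h1, ← (ℛ k x).eq]
  simp [Finset.smul_sum, mul_smul]

/-- The hypothesis `hl` says α = l². Translation is multiplicative, so ∑ l(y')x_l y'' is the
translate of xy, namely α(y)x_l = ∑ l(y')l(y'')x_l. The convolution-invertible factor l then
cancels. -/
lemma translate_mul {α : Module.Dual k A} (hα : IsModulus x α)
    (hl : ∀ z, α z = l (translate l z)) (z : A) :
    translate l x * z = l z • translate l x := by
  let L : A →ₐ[k] A := (Algebra.ofId k A).comp l
  have hL : ∀ z, toConv L.toLinearMap z = l z • (1 : A) := fun z =>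
    Algebra.algebraMap_eq_smul_one _
  let ρ : WithConv (A →ₗ[k] A) := toConv (LinearMap.mulLeft k (translate l x))
  let τ : WithConv (A →ₗ[k] A) := toConv (l.toLinearMap.smulRight (translate l x))
  have h1 : toConv L.toLinearMap * ρ = toConv L.toLinearMap * τ := by
    apply WithConv.ext; ext1 y
    rw [conv_mul_apply, conv_mul_apply]
    have e1 : ∑ i ∈ (ℛ k y).index, l ((ℛ k y).left i) • (translate l x * (ℛ k y).right i) =
        contractLeft l.toLinearMap (comul (x * y)) := by
      rw [← translate, translate_mul_distrib]
      conv_rhs => rw [translate.eq_1 l y, ← (ℛ k y).eq]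
      simp [Finset.mul_sum]
    have e2 : ∑ i ∈ (ℛ k y).index, l ((ℛ k y).left i) • (l ((ℛ k y).right i) • translate l x) =
        α y • translate l x := by
      rw [hl, translate.eq_1 l y, ← (ℛ k y).eq]
      simp [Finset.sum_smul, smul_smul]
    simp only [hL, smul_mul_assoc, one_mul]
    refine e1.trans (Eq.trans ?_ e2.symm)
    rw [← translate, hα, translate, map_smul, map_smul]; rfl
  have h2 : ρ = τ := by
    rw [← one_mul ρ, ← conv_antipode_mul L, mul_assoc, h1, ← mul_assoc, conv_antipode_mul, one_mul]
  exact conv_apply_ext h2 z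

/-- This evaluates ∑ μ(S(h)x')x'' in two ways. It compares μ(S(h)) with μ(ha), so each use gains one
antipode. -/
lemma smul_translate_eq (hx : IsLeftCointegral k x) (hμx : μ x = 1) (ha : IsComodulus μ a) {h : A}
    (hh : ∀ y, antipode k h * y = l y • antipode k h) :
    μ (antipode k h) • translate l x = h * a := by
  rw [← frobeniusMap_antipode hx hμx ha, frobeniusMap_eq, translate, ← (ℛ k x).eq]
  simp [hh, Finset.smul_sum, smul_smul, mul_comm]

/-- `μ(S(S²(x_l) g)) = l(g) l(a)³`, where `x_l = ∑ l(x') x''` and the modulus is `l²`. -/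
lemma apply_antipode_translate [HasBijectiveAntipode k A] (hμ : IsLeftIntegral μ)
    (hx : IsLeftCointegral k x) (hμx : μ x = 1) (ha : IsComodulus μ a)
    {α : Module.Dual k A} (hα : IsModulus x α)
    (hl : ∀ z, α z = l (translate l z))
    (hS : ∀ z, l (antipode k (antipode k z)) = l z) (g : A) :
    μ (antipode k (antipode k (antipode k (translate l x)) * g)) = l g * l a ^ 3 := by
  set t := translate l x with ht
  have hsurj : ∀ y : A, ∃ z, antipode k z = y := fun y => ⟨_, antipode_antipodeInv y⟩
  have m1 : ∀ z, z * t = l (antipode k z) • t := mul_translate l hx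
  have m2 : ∀ z, t * z = l z • t := translate_mul l hα hl
  -- The left action on t is by l ∘ S and the right action by l. Since l ∘ S² = l, every S-power of
  -- t considered here has l as its right character.
  have p1 : ∀ y, antipode k t * y = l y • antipode k t := by
    intro y
    obtain ⟨z, rfl⟩ := hsurj y
    rw [← antipode_mul_antidistrib, m1, map_smul]
  have p2 : ∀ y, antipode k (antipode k t) * y = l y • antipode k (antipode k t) := by
    intro y
    obtain ⟨z, rfl⟩ := hsurj y
    obtain ⟨z, rfl⟩ := hsurj z
    rw [← antipode_mul_antidistrib, ← antipode_mul_antidistrib, m2, map_smul, map_smul, hS]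
  have p3 : ∀ y, antipode k (antipode k (antipode k t)) * y =
      l y • antipode k (antipode k (antipode k t)) := by
    intro y
    obtain ⟨z, rfl⟩ := hsurj y
    obtain ⟨z, rfl⟩ := hsurj z
    rw [← antipode_mul_antidistrib, ← antipode_mul_antidistrib, p1, map_smul, map_smul, hS]
  have ht1 : μ t = 1 := apply_translate l hμ hμx
  -- Taking h = t, S(t), S²(t) in turn, each value μ(S(h)) is l(a) times μ(h), starting from μ(t) =
  -- 1. This explains the exponent 3.
  have k1 := congrArg μ (smul_translate_eq l hx hμx ha p1)
  have k2 := congrArg μ (smul_translate_eq l hx hμx ha p2)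
  have k3 := congrArg μ (smul_translate_eq l hx hμx ha p3)
  rw [← ht, map_smul, ht1, m2, map_smul, ht1] at k1
  rw [← ht, map_smul, ht1, p1, map_smul] at k2
  rw [← ht, map_smul, ht1, p2, map_smul] at k3
  simp only [smul_eq_mul, mul_one] at k1 k2 k3
  rw [p2, map_smul, map_smul, k3, k2, k1, smul_eq_mul]
  ring

end Character
end Integrals

/-! ### The integral and the group-like elements of the double -/

namespace DrinfeldDouble
variable {k A : Type*} [Field k] [Ring A] [HopfAlgebra k A] [HasBijectiveAntipode k A]

lemma integral_apply (μ : Module.Dual k A) (x : A) (l : CoopDual k A) (y : A) :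
    integral μ x (ofDual k A l * ofAlg k A y) = l x * μ (antipode k y) := by
  rw [ofDual_mul_ofAlg]; rfl

lemma contraction_apply (l : CoopDual k A) (y : A) :
    contraction k A (ofDual k A l * ofAlg k A y) = l y := by
  rw [ofDual_mul_ofAlg]; rfl

variable [FiniteDimensional k A]

/-- As a coalgebra D(A) is A° ⊗ A, so it suffices that evaluation at x is right invariant on A° and
that μ ∘ S is right invariant on A. The first is the cointegral property, the second is invariance
of μ transported by S. -/
lemma isRightIntegral_integral {μ : Module.Dual k A} {x : A} (hμ : IsLeftIntegral μ)
    (hx : IsLeftCointegral k x) : IsRightIntegral (integral μ x) := by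
  have h1 : ∀ l : CoopDual k A, ∑ r ∈ (ℛ k l).index, (ℛ k l).left r x • (ℛ k l).right r =
      l x • 1 := by
    intro l
    rw [sum_left_smul_right]
    refine coopDual_ext fun b => ?_
    rw [actL_apply, hx, map_smul, map_smul, LinearMap.smul_apply, coop_one_apply, smul_eq_mul,
      smul_eq_mul, mul_comm]
  have h2 : ∀ y : A, ∑ r ∈ (ℛ k y).index, μ (antipode k ((ℛ k y).left r)) • (ℛ k y).right r =
      μ (antipode k y) • 1 := by
    intro y
    apply antipode_inj (k := k)
    rw [map_smul, antipode_one, ← hμ.contractRight_comul, comul_antipode, ← (ℛ k y).eq]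
    simp
  intro s
  induction s using induction_on with
  | hadd a b ha hb => simp only [map_add, ha, hb, add_smul]
  | h l y =>
    have h3 := congrArg₂ (fun a b => ofDual k A a * ofAlg k A b) (h1 l) (h2 y)
    simp only [map_sum, map_smul, Finset.sum_mul_sum, smul_mul_smul_comm, map_one, mul_one] at h3
    rw [comul_mul_repr, integral_apply, ← h3]
    simp only [map_sum, LinearMap.rTensor_tmul, TensorProduct.lid_tmul, integral_apply]

variable (k A) in
/-- The map `l · y ↦ ε(y) l`. -/
def projDual : DrinfeldDouble k A →ₗ[k] CoopDual k A :=
  (TensorProduct.rid k (CoopDual k A)).toLinearMap ∘ₗ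
    (counit (R := k) (A := A)).lTensor (CoopDual k A) ∘ₗ (toTensor k A).toLinearMap

variable (k A) in
/-- The map `l · y ↦ ε(l) y`. -/
def projAlg : DrinfeldDouble k A →ₗ[k] A :=
  (TensorProduct.lid k A).toLinearMap ∘ₗ
    (counit (R := k) (A := CoopDual k A)).rTensor A ∘ₗ (toTensor k A).toLinearMap

omit [FiniteDimensional k A] in
lemma projDual_apply (l : CoopDual k A) (y : A) :
    projDual k A (ofDual k A l * ofAlg k A y) = counit (R := k) y • l := by
  rw [ofDual_mul_ofAlg]; rfl

lemma projAlg_apply (l : CoopDual k A) (y : A) :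
    projAlg k A (ofDual k A l * ofAlg k A y) = counit (R := k) l • y := by
  rw [ofDual_mul_ofAlg]; rfl

/-- The counits remove the inner two of the four factors in Δ(l·y). Together with comultiplicativity
of both projections, this factors every group-like element. -/
lemma map_proj_comul (s : DrinfeldDouble k A) :
    TensorProduct.map (projDual k A) (projAlg k A) (comul (R := k) s) = toTensor k A s := by
  induction s using induction_on with
  | hadd a b ha hb => simp only [map_add, ha, hb]
  | h l y =>
    have h1 : ∑ i ∈ (ℛ k l).index, counit (R := k) ((ℛ k l).right i) • (ℛ k l).left i = l := by
      have := congr(TensorProduct.rid k _ $(sum_tmul_counit_eq (ℛ k l)))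
      rw [map_sum] at this
      simpa only [TensorProduct.rid_tmul, one_smul] using this
    rw [comul_mul_repr]
    simp only [map_sum, TensorProduct.map_tmul, projDual_apply, projAlg_apply]
    rw [ofDual_mul_ofAlg, LinearEquiv.apply_symm_apply]
    conv_rhs => rw [← h1, ← sum_counit_smul (ℛ k y)]
    simp only [TensorProduct.sum_tmul, TensorProduct.tmul_sum, TensorProduct.smul_tmul_smul]
    rw [Finset.sum_comm]
    simp only [mul_comm]

lemma comul_projDual (s : DrinfeldDouble k A) : comul (R := k) (projDual k A s) =
    TensorProduct.map (projDual k A) (projDual k A) (comul (R := k) s) := by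
  induction s using induction_on with
  | hadd a b ha hb => simp only [map_add, ha, hb]
  | h l y =>
    rw [comul_mul_repr, projDual_apply, map_smul]
    simp only [map_sum, TensorProduct.map_tmul, projDual_apply]
    conv_lhs => rw [← (ℛ k l).eq, ← sum_counit_smul (ℛ k y)]
    simp only [TensorProduct.smul_tmul_smul, map_sum, map_smul, smul_eq_mul, ← Finset.sum_smul,
      Finset.smul_sum]

lemma comul_projAlg (s : DrinfeldDouble k A) : comul (R := k) (projAlg k A s) =
    TensorProduct.map (projAlg k A) (projAlg k A) (comul (R := k) s) := by
  induction s using induction_on with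
  | hadd a b ha hb => simp only [map_add, ha, hb]
  | h l y =>
    rw [comul_mul_repr, projAlg_apply, map_smul]
    simp only [map_sum, TensorProduct.map_tmul, projAlg_apply]
    conv_lhs => rw [← (ℛ k y).eq, ← sum_counit_smul (ℛ k l)]
    rw [Finset.sum_comm]
    simp only [TensorProduct.smul_tmul_smul, map_sum, map_smul, smul_eq_mul, ← Finset.sum_smul,
      Finset.smul_sum]

lemma counit_projDual (s : DrinfeldDouble k A) :
    counit (R := k) (projDual k A s) = counit (R := k) s := by
  induction s using induction_on with
  | hadd a b ha hb => simp only [map_add, ha, hb]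
  | h l y =>
    rw [projDual_apply, map_smul, Bialgebra.counit_mul, counit_ofDual, counit_ofAlg, smul_eq_mul,
      mul_comm]

lemma counit_projAlg (s : DrinfeldDouble k A) :
    counit (R := k) (projAlg k A s) = counit (R := k) s := by
  induction s using induction_on with
  | hadd a b ha hb => simp only [map_add, ha, hb]
  | h l y =>
    rw [projAlg_apply, map_smul, Bialgebra.counit_mul, counit_ofDual, counit_ofAlg, smul_eq_mul]

/-- A group-like element of the double is a product of group-like elements. -/
lemma exists_eq_mul_of_isGroupLikeElem {κ : DrinfeldDouble k A} (hκ : IsGroupLikeElem k κ) :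
    ∃ (l : CoopDual k A) (g : A), IsGroupLikeElem k l ∧ IsGroupLikeElem k g ∧
      κ = ofDual k A l * ofAlg k A g := by
  refine ⟨projDual k A κ, projAlg k A κ, ⟨?_, ?_⟩, ⟨?_, ?_⟩, ?_⟩
  · rw [counit_projDual, hκ.counit_eq_one]
  · rw [comul_projDual, hκ.comul_eq_tmul_self, TensorProduct.map_tmul]
  · rw [counit_projAlg, hκ.counit_eq_one]
  · rw [comul_projAlg, hκ.comul_eq_tmul_self, TensorProduct.map_tmul]
  · rw [ofDual_mul_ofAlg, LinearEquiv.eq_symm_apply, ← map_proj_comul, hκ.comul_eq_tmul_self,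
      TensorProduct.map_tmul]

end DrinfeldDouble

/-! ### Group-like elements of A° as characters of A -/

section
variable {k A : Type*} [Field k] [Ring A] [HopfAlgebra k A] [FiniteDimensional k A]

lemma coop_isGroupLikeElem_mul {l : CoopDual k A} (hl : IsGroupLikeElem k l) (y z : A) :
    l (y * z) = l y * l z := by
  rw [← pairAt_coopComul, ← coop_comul_eq, hl.comul_eq_tmul_self, pairAt_tmul, mul_comm]

lemma coop_isGroupLikeElem_one {l : CoopDual k A} (hl : IsGroupLikeElem k l) : l 1 = 1 := by
  rw [← coop_counit_eq, hl.counit_eq_one]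

/-- The character given by a group-like element of `A°`. -/
def character {l : CoopDual k A} (hl : IsGroupLikeElem k l) : A →ₐ[k] k :=
  AlgHom.ofLinearMap (toDual k A l) (coop_isGroupLikeElem_one hl) (coop_isGroupLikeElem_mul hl)

@[simp] lemma character_apply {l : CoopDual k A} (hl : IsGroupLikeElem k l) (y : A) :
    character hl y = l y := rfl

lemma coop_mul_eq_translate {l : CoopDual k A} (hl : IsGroupLikeElem k l) (m : CoopDual k A)
    (y : A) : (l * m) y = m (translate (character hl) y) := by
  rw [conv_apply, translate, ← (ℛ k y).eq]
  simp

/-- A group-like element is fixed by the square of the antipode, and on A° that square is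
precomposition with S⁻². -/
lemma character_antipode_antipode [HasBijectiveAntipode k A] {l : CoopDual k A}
    (hl : IsGroupLikeElem k l) (y : A) : l (antipode k (antipode k y)) = l y := by
  conv_lhs => rw [← hl.antipode_antipode]
  rw [coop_antipode_apply, coop_antipode_apply, antipodeInv_antipode, antipodeInv_antipode]

end

/-! ### The square of a balancing in terms of the moduli -/

namespace DrinfeldDouble
variable {k A : Type*} [Field k] [Ring A] [HopfAlgebra k A] [HasBijectiveAntipode k A]
  [FiniteDimensional k A]

/-- Both translates of l by g are l(g)l, so the commutation relation at (l, g) is the claim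
multiplied by the nonzero number l(g). -/
lemma ofAlg_mul_ofDual_of_isGroupLikeElem {l : CoopDual k A} {g : A} (hl : IsGroupLikeElem k l)
    (hg : IsGroupLikeElem k g) :
    ofAlg k A g * ofDual k A l = ofDual k A l * ofAlg k A g := by
  let r : Repr k g Unit := ⟨{()}, fun _ => g, fun _ => g, by
    rw [Finset.sum_singleton, hg.comul_eq_tmul_self]⟩
  have h := conv_apply_ext (matched_ofDual_ofAlg (k := k) (A := A) l) g
  rw [r.convMul_apply, r.convMul_apply] at h
  simp only [r, Finset.sum_singleton, transR_apply, transL_apply] at h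
  have hR : actR g l = l g • l := coopDual_ext fun y => by
    rw [actR_apply, coop_isGroupLikeElem_mul hl]; rfl
  have hL : actL g l = l g • l := coopDual_ext fun y => by
    rw [actL_apply, coop_isGroupLikeElem_mul hl, mul_comm]; rfl
  rw [hR, hL, map_smul, mul_smul_comm, smul_mul_assoc] at h
  have hne : l g ≠ 0 := by
    intro h0
    have := coop_isGroupLikeElem_mul hl g (antipode k g)
    rw [hg.mul_antipode_cancel, coop_isGroupLikeElem_one hl, h0, zero_mul] at this
    exact one_ne_zero this
  exact smul_right_injective _ hne h

variable {ι : Type*} [Fintype ι] (e : Module.Basis ι k A)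

/-- `S(u a) = S(α) u`. -/
lemma antipode_canonicalU_mul {μ α : Module.Dual k A} {x a : A} (hμ : IsLeftIntegral μ)
    (hx : IsLeftCointegral k x) (hμx : μ x = 1) (hα : IsModulus x α) (ha : IsComodulus μ a) :
    antipode k (canonicalU e * ofAlg k A a) =
      antipode k (ofDual k A ((toDual k A).symm α)) * canonicalU e := by
  set m : CoopDual k A := (toDual k A).symm μ with hm
  have hd : ∀ i, dualElt e i = ofDual k A (dualVec e i) := fun _ => rfl
  have hs : ∀ l : CoopDual k A, ofDual k A l = ∑ j, l (e j) • dualElt e j := by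
    intro l
    conv_lhs => rw [← sum_smul_dualVec e l]
    simp only [map_sum, map_smul, hd]
  -- This and `e2` turn the right side of the commutation relation at (μ, x) into ua. The other
  -- side, after S, is handled by `e3` and `e4`.
  have e1 : ∑ i ∈ (ℛ k x).index, ofDual k A (actL ((ℛ k x).left i) m) *
      ofAlg k A ((ℛ k x).right i) = ∑ i, dualElt e i * ofAlg k A (frobeniusMap μ x (e i)) := by
    have : ∀ i, frobeniusMap μ x (e i) = ∑ t ∈ (ℛ k x).index,
        (actL ((ℛ k x).left t) m) (e i) • (ℛ k x).right t := by
      intro i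
      rw [frobeniusMap_eq, ← (ℛ k x).eq, map_sum]
      simp only [contractLeft_tmul]
      rfl
    simp only [this, map_sum, map_smul, Finset.mul_sum]
    rw [Finset.sum_comm]
    refine Finset.sum_congr rfl fun t _ => ?_
    rw [hs, Finset.sum_mul]
    simp only [smul_mul_assoc, mul_smul_comm]
  have e2 : ∑ i, dualElt e i * ofAlg k A (frobeniusMap μ x (e i)) =
      canonicalU e * ofAlg k A a := by
    have h1 := congrArg (LinearMap.mul' k _ ∘ₗ (TensorProduct.comm k _ _).toLinearMap ∘ₗ
      TensorProduct.map ((ofAlg k A).toLinearMap ∘ₗ frobeniusMap μ x) (ofDual k A).toLinearMap)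
      (sum_antipode_tmul_dualVec e)
    simp only [map_sum, LinearMap.comp_apply, TensorProduct.map_tmul, LinearEquiv.coe_coe,
      TensorProduct.comm_tmul, LinearMap.mul'_apply, frobeniusMap_antipode hx hμx ha,
      AlgHom.toLinearMap_apply, ← antipode_ofDual] at h1
    refine h1.symm.trans ?_
    rw [canonicalU, Finset.sum_mul]
    simp only [map_mul, ← mul_assoc]
    rfl
  have e3 : antipode k (∑ i ∈ (ℛ k x).index, ofAlg k A ((ℛ k x).left i) *
      ofDual k A (actR ((ℛ k x).right i) m)) =
      ∑ i, antipode k (dualElt e i) * ofAlg k A (contractRight α (comul (e i))) := by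
    have : ∀ i, contractRight α (comul (e i)) = ∑ t ∈ (ℛ k x).index,
        (actR ((ℛ k x).right t) m) (e i) • antipode k ((ℛ k x).left t) := by
      intro i
      -- By the normalisation μ(x) = 1, α(y) = μ(xy), which puts the sum in the form required by
      -- `IsLeftIntegral.shift`.
      have h1 : α = μ ∘ₗ LinearMap.mulLeft k x := by
        ext y
        rw [LinearMap.comp_apply, LinearMap.mulLeft_apply, hα, map_smul, hμx, smul_eq_mul, mul_one]
      rw [h1, ← hμ.shift, ← (ℛ k x).eq, map_sum, map_sum]
      simp only [contractRight_tmul, map_smul]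
      rfl
    simp only [this, map_sum, map_smul, Finset.mul_sum, antipode_mul_antidistrib, antipode_ofAlg]
    rw [Finset.sum_comm]
    refine Finset.sum_congr rfl fun t _ => ?_
    rw [hs, map_sum, Finset.sum_mul]
    simp only [map_smul, smul_mul_assoc, mul_smul_comm]
  have e4 : ∑ i, antipode k (dualElt e i) * ofAlg k A (contractRight α (comul (e i))) =
      antipode k (ofDual k A ((toDual k A).symm α)) * canonicalU e := by
    have h1 := congrArg (LinearMap.mul' k _ ∘ₗ (TensorProduct.comm k _ _).toLinearMap ∘ₗ
      TensorProduct.map ((ofAlg k A).toLinearMap ∘ₗ contractRight α)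
        (antipode k ∘ₗ (ofDual k A).toLinearMap))
      (sum_comul_tmul_dualVec e)
    simp only [map_sum, LinearMap.comp_apply, TensorProduct.map_tmul, LinearEquiv.coe_coe,
      TensorProduct.comm_tmul, LinearMap.mul'_apply,
      AlgHom.toLinearMap_apply, contractRight_tmul, map_smul, map_mul, antipode_mul_antidistrib,
      ← hd] at h1
    refine h1.trans ?_
    rw [Finset.sum_comm, hs, map_sum, Finset.sum_mul]
    refine Finset.sum_congr rfl fun q _ => ?_
    rw [canonicalU, Finset.mul_sum]
    refine Finset.sum_congr rfl fun p _ => ?_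
    rw [mul_smul_comm, map_smul, smul_mul_assoc, mul_assoc]
    rfl
  rw [← e2, ← e1, ← matched_apply, e3, e4]

lemma isBalancingElt {κ : GroupLike k (DrinfeldDouble k A)} (hκ : IsBalancing e κ) :
    IsBalancingElt k (basisElt e) (dualElt e) (κ : DrinfeldDouble k A) :=
  ⟨κ.2, hκ.1, hκ.2⟩

/-- The square of a balancing is `α a⁻¹`. -/
lemma balancing_sq_mul {μ α : Module.Dual k A} {x a : A} (hμ : IsLeftIntegral μ)
    (hx : IsLeftCointegral k x) (hμx : μ x = 1) (hα : IsModulus x α) (ha : IsComodulus μ a)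
    {κ : DrinfeldDouble k A} (hκ : IsBalancingElt k (basisElt e) (dualElt e) κ) :
    κ ^ 2 * ofAlg k A a = ofDual k A ((toDual k A).symm α) := by
  have hR := isUniversalR e
  have h1 := antipode_canonicalU_mul e hμ hx hμx hα ha
  have h2 : κ ^ 2 * antipode k (canonicalU e) = canonicalU e := hκ.sq_mul_antipode hR
  have h3 : antipode k (canonicalU e) * antipode k (drinfeldInv k (basisElt e) (dualElt e)) = 1 := by
    rw [← antipode_mul_antidistrib]
    exact (congrArg _ hR.drinfeldInv_mul).trans antipode_one
  -- Substitute u = κ²S(u) in S(a)S(u)... i.e. in the image of ua under S, and cancel the invertible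
  -- S(u) on the right.
  have h4 : antipode k (ofAlg k A a) = antipode k (ofDual k A ((toDual k A).symm α)) * κ ^ 2 := by
    have := congrArg (· * antipode k (drinfeldInv k (basisElt e) (dualElt e))) h1
    rw [antipode_mul_antidistrib] at this
    conv_rhs at this => rw [← h2]
    simpa only [mul_assoc, h3, mul_one] using this
  have hg := hκ.isGroupLikeElem
  have h5 : κ ^ 2 = antipode k (antipode k κ * antipode k κ) := by
    rw [antipode_mul_antidistrib, hg.antipode_antipode, pow_two]
  rw [h5, ← antipode_mul_antidistrib] at h4
  rw [hκ.antipode_injective h4, pow_two]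
  simp only [← mul_assoc]
  rw [mul_assoc κ κ, hg.mul_antipode_cancel, mul_one, hg.mul_antipode_cancel, one_mul]

end DrinfeldDouble

/-! ### Evaluation of the integral on the inverse ribbon element -/

namespace DrinfeldDouble
variable {k A : Type*} [Field k] [Ring A] [HopfAlgebra k A] [HasBijectiveAntipode k A]
  [FiniteDimensional k A] {ι : Type*} [Fintype ι] (e : Module.Basis ι k A)

/-- For a balancing `κ = l · g` one has `l² = α` and `g² = a⁻¹`. -/
lemma sq_eq_modulus {μ α : Module.Dual k A} {x a : A} (hμ : IsLeftIntegral μ)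
    (hx : IsLeftCointegral k x) (hμx : μ x = 1) (hα : IsModulus x α) (ha : IsComodulus μ a)
    {l : CoopDual k A} {g : A} (hl : IsGroupLikeElem k l) (hg : IsGroupLikeElem k g)
    (hκ : IsBalancingElt k (basisElt e) (dualElt e) (ofDual k A l * ofAlg k A g)) :
    l * l = (toDual k A).symm α ∧ g * g * a = 1 := by
  have h1 := balancing_sq_mul e hμ hx hμx hα ha hκ
  have h2 : ofDual k A (l * l) * ofAlg k A (g * g * a) =
      ofDual k A ((toDual k A).symm α) * ofAlg k A 1 := by
    rw [map_one, mul_one, ← h1, pow_two, mul_assoc (ofDual k A l), ← mul_assoc (ofAlg k A g),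
      ofAlg_mul_ofDual_of_isGroupLikeElem hl hg]
    simp only [map_mul, mul_assoc]
  have hx0 : x ≠ 0 := by
    rintro rfl
    rw [map_zero] at hμx
    exact zero_ne_one hμx
  have hα1 : α 1 = 1 := by
    have := hα 1
    rw [mul_one] at this
    exact smul_left_injective k hx0 (by simpa using this.symm)
  -- Apply ε to ∑ μ(x')x'' = a. With α(1) = 1 this lets the projections to A° and A separate the
  -- equation `h2` into its two factors.
  have ha1 : counit (R := k) a = 1 := by
    have h3 := congrArg (counit (R := k)) (ha.contractLeft_comul x)
    have h4 : counit (R := k) (contractLeft μ (comul x)) = μ x := by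
      conv_rhs => rw [← sum_right_counit_smul (k := k) x]
      rw [← (ℛ k x).eq]
      simp [mul_comm]
    rw [h4, map_smul, hμx, smul_eq_mul, one_mul] at h3
    exact h3.symm
  constructor
  · have := congrArg (projDual k A) h2
    simpa only [projDual_apply, Bialgebra.counit_mul, hg.counit_eq_one, ha1, one_mul, one_smul,
      Bialgebra.counit_one] using this
  · have := congrArg (projAlg k A) h2
    have h5 : counit (R := k) ((toDual k A).symm α : CoopDual k A) = 1 := hα1
    simpa only [projAlg_apply, Bialgebra.counit_mul, hl.counit_eq_one, h5, one_mul,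
      one_smul] using this

/-- Since S²(g) = g, g commutes with u⁻¹; moving it to the right puts κu⁻¹ into the form A°·A on
which μ_D is defined. -/
lemma ribbonInv_eq {l : CoopDual k A} {g : A} (hg : IsGroupLikeElem k g) :
    ribbonInv k (basisElt e) (dualElt e) (ofDual k A l * ofAlg k A g) =
      ∑ i, ofDual k A (l * dualVec e i) * ofAlg k A (antipode k (antipode k (e i)) * g) := by
  have hR := isUniversalR e
  set u := drinfeldElt k (basisElt e) (dualElt e) with hu
  set u' := drinfeldInv k (basisElt e) (dualElt e) with hu'
  have h1 : u * ofAlg k A g = ofAlg k A g * u := by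
    rw [hu, hR.drinfeldElt_mul, antipode_ofAlg, antipode_ofAlg, hg.antipode_antipode]
  have h2 : ofAlg k A g * u' = u' * ofAlg k A g := by
    calc _ = u' * (u * ofAlg k A g) * u' := by
          rw [← mul_assoc, hR.drinfeldInv_mul, one_mul]
      _ = _ := by rw [h1, mul_assoc, mul_assoc, hR.drinfeldElt_mul_inv, mul_one]
  rw [ribbonInv, ← hu', mul_assoc, h2, hu', drinfeldInv, Finset.sum_mul, Finset.mul_sum]
  refine Finset.sum_congr rfl fun i _ => ?_
  rw [basisElt, antipode_ofAlg, antipode_ofAlg, map_mul, map_mul]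
  simp only [mul_assoc]
  rfl

/-- `μ_D(v⁻¹) = l(g) l(a)³` for a balancing `κ = l · g`. -/
lemma integral_ribbonInv {μ α : Module.Dual k A} {x a : A} (hμ : IsLeftIntegral μ)
    (hx : IsLeftCointegral k x) (hμx : μ x = 1) (hα : IsModulus x α) (ha : IsComodulus μ a)
    {l : CoopDual k A} {g : A} (hl : IsGroupLikeElem k l) (hg : IsGroupLikeElem k g)
    (hlα : l * l = (toDual k A).symm α) :
    integral μ x (ribbonInv k (basisElt e) (dualElt e) (ofDual k A l * ofAlg k A g)) =
      l g * l a ^ 3 := by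
  have hα' : ∀ z, α z = character hl (translate (character hl) z) := fun z => by
    rw [character_apply, ← coop_mul_eq_translate, hlα]; rfl
  have := apply_antipode_translate (character hl) hμ hx hμx ha hα hα'
    (character_antipode_antipode hl) g
  rw [character_apply, character_apply] at this
  rw [ribbonInv_eq e hg, map_sum, ← this]
  -- Since (l f_i)(x) is the i-th coordinate of x_l, the sum over the basis reassembles x_l inside
  -- μ(S(S²(·)g)).
  conv_rhs => rw [← sum_dualVec_smul e (translate (character hl) x)]
  simp only [integral_apply, coop_mul_eq_translate hl, map_sum, map_smul, Finset.sum_mul,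
    smul_mul_assoc, smul_eq_mul]

end DrinfeldDouble
end HopfDouble
end

/-! ### The modular relation -/

open HopfDouble HopfDouble.DrinfeldDouble in
theorem mainTheorem5 {k A : Type*} [Field k] [Ring A] [HopfAlgebra k A] [FiniteDimensional k A]
    [HopfDouble.HasBijectiveAntipode k A]
    (μ : Module.Dual k A) (x : A) (hμ : HopfDouble.IsLeftIntegral μ)
    (hx : HopfDouble.IsLeftCointegral k x) (hμx : μ x = 1)
    (α : Module.Dual k A) (a : A) (hα : HopfDouble.IsModulus x α)
    (ha : HopfDouble.IsComodulus μ a)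
    {ι : Type*} [Fintype ι] (e : Module.Basis ι k A)
    (κ : GroupLike k (HopfDouble.DrinfeldDouble k A))
    (hκ : HopfDouble.DrinfeldDouble.IsBalancing e κ) :
    HopfDouble.DrinfeldDouble.nu κ ^ 4 = α a ∧
    ∃ T : HopfDouble.DrinfeldDouble k A ≃ₗ[k] HopfDouble.DrinfeldDouble k A,
      (∀ X, T X = HopfDouble.DrinfeldDouble.ribbon e κ * X) ∧
      HopfDouble.DrinfeldDouble.opS e μ x ∘ₗ T.symm.toLinearMap ∘ₗ
          HopfDouble.DrinfeldDouble.opS e μ x =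
        HopfDouble.DrinfeldDouble.nu κ ^ 5 •
          (T.toLinearMap ∘ₗ HopfDouble.DrinfeldDouble.opS e μ x ∘ₗ T.toLinearMap) := by
  have hB := isBalancingElt e hκ
  have hR := isUniversalR e
  obtain ⟨l, g, hl, hg, hlg⟩ := exists_eq_mul_of_isGroupLikeElem κ.2
  have hB' := hB
  rw [hlg] at hB'
  obtain ⟨hlα, hga⟩ := sq_eq_modulus e hμ hx hμx hα ha hl hg hB'
  have hν : nu κ = (l g)⁻¹ := by rw [nu, hlg, contraction_apply]
  -- The character l applied to g²a = 1; below, α = l² applied to the same equation gives ω.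
  have hla : l g * l g * l a = 1 := by
    rw [← coop_isGroupLikeElem_mul hl, ← coop_isGroupLikeElem_mul hl, hga,
      coop_isGroupLikeElem_one hl]
  have hαa : l g ^ 4 * α a = 1 := by
    have h1 : ∀ y z, α (y * z) = α y * α z := by
      have := coop_isGroupLikeElem_mul (hl.mul hl)
      rwa [hlα] at this
    have h2 : α g = l g * l g := by
      have h3 : α g = (l * l) g := by rw [hlα]; rfl
      rw [h3, coop_mul_eq_translate hl, HopfDouble.translate, hg.comul_eq_tmul_self, contractLeft_tmul,
        map_smul, smul_eq_mul]
      rfl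
    have h4 : α (g * g * a) = 1 := by
      rw [hga]
      have := coop_isGroupLikeElem_one (hl.mul hl)
      rwa [hlα] at this
    rw [h1, h1, h2] at h4
    rw [← h4]
    ring
  -- This makes the inverse defining ν a genuine one.
  have hne : l g ≠ 0 := fun h0 => by simp [h0] at hla
  -- The value l(g)l(a)³ with l(g) = ν⁻¹ and l(a) = ν².
  have hc : integral μ x (ribbonInv k (basisElt e) (dualElt e) κ) = nu κ ^ 5 := by
    rw [hlg, integral_ribbonInv e hμ hx hμx hα ha hl hg hlα, hν]
    have h1 : l a = ((l g)⁻¹) ^ 2 := by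
      field_simp
      linear_combination hla
    rw [h1]
    field_simp
  refine ⟨?_, ?_⟩
  · rw [hν]
    field_simp
    linear_combination -hαa
  · let T : DrinfeldDouble k A ≃ₗ[k] DrinfeldDouble k A :=
      LinearEquiv.ofLinearMap
        (LinearMap.mulLeft k (ribbonElt k (basisElt e) (dualElt e) (κ : DrinfeldDouble k A)))
        (LinearMap.mulLeft k (ribbonInv k (basisElt e) (dualElt e) (κ : DrinfeldDouble k A)))
        (by
          rw [← LinearMap.mulLeft_mul, hB.ribbonElt_mul_ribbonInv hR, LinearMap.mulLeft_one])
        (by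
          rw [← LinearMap.mulLeft_mul, hB.ribbonInv_mul_ribbonElt hR, LinearMap.mulLeft_one])
    refine ⟨T, fun X => rfl, LinearMap.ext fun X => ?_⟩
    rw [← hc]
    exact hB.transformS_relation hR (isRightIntegral_integral hμ hx) X
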